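/- Let $(X,\mu)$ be a measure space with $\sigma$-finite measure $\mu$, and let $A$ be a non-negative self-adjoint operator on (real or complex) $L^2(X,\mu)$ with domain $\mathcal D(A)$ and spectral resolution $A=\int_0^\infty\lambda\,dE_\lambda$. Put $T_t=e^{-tA}=\int_0^\infty e^{-t\lambda}\,dE_\lambda$ for $t>0$, and define $A^{1/2}$ by $$(A^{1/2}f,f)=\int_0^\infty\lambda^{1/2}\,d(E_\lambda f,f),\qquad f\in\mathcal D(A^{1/2})=\Big\{f\in L^2:\int_0^\infty\lambda\,d(E_\lambda f,f)<\infty\Big\}.$$ Suppose that $T_t$ acts as a contraction on $L^1$ for all $t>0$, that is, $\|T_tf\|_1\le\|f\|_1$ for all $f\in L^1\cap L^2$. Assume that there is a non-decreasing function $B:[0,\infty)\to[0,\infty)$ such that $$\|f\|_2^2\,B(\|f\|_2^2)\le(Af,f)\qquad\text{for all } f\in\mathcal D(A)\text{ with }\|f\|_1=1.$$ Then, for all $\varepsilon\in(0,1)$, $$(1-\varepsilon^2)^{1/2}\,\|f\|_2^2\,\big[B(\varepsilon\|f\|_2^2)\big]^{1/2}\le(A^{1/2}f,f)\qquad\text{for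 all } f\in\mathcal D(A^{1/2})\text{ with }\|f\|_1=1.$$ -/

import Mathlib

open MeasureTheory
open scoped NNReal ENNReal

noncomputable section

/-- A resolution of the identity `E` on the half-line `[0, ∞)` with values in the orthogonal
projections of the Hilbert space `H`: a strongly countably additive projection-valued measure with
`E [0, ∞) = 1`. Only the values at Borel sets matter. -/
structure ResolutionOfIdentity (𝕜 H : Type*) [RCLike 𝕜] [NormedAddCommGroup H]
    [InnerProductSpace 𝕜 H] [CompleteSpace H] where
  proj : Set ℝ≥0 → H →L[𝕜] H
  isStarProjection : ∀ s, MeasurableSet s → IsStarProjection (proj s)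
  proj_univ : proj Set.univ = 1
  hasSum_iUnion : ∀ s : ℕ → Set ℝ≥0, (∀ i, MeasurableSet (s i)) →
    Pairwise (Function.onFun Disjoint s) →
    ∀ f : H, HasSum (fun i => proj (s i) f) (proj (⋃ i, s i) f)

namespace ResolutionOfIdentity

variable {𝕜 H : Type*} [RCLike 𝕜] [NormedAddCommGroup H] [InnerProductSpace 𝕜 H] [CompleteSpace H]

theorem proj_empty_apply (E : ResolutionOfIdentity 𝕜 H) (f : H) : E.proj ∅ f = 0 := by
  have h := E.hasSum_iUnion (fun _ => ∅) (fun _ => MeasurableSet.empty)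
    (fun _ _ _ => disjoint_bot_left) f
  exact tendsto_nhds_unique tendsto_const_nhds h.summable.tendsto_atTop_zero

theorem inner_proj_nonneg (E : ResolutionOfIdentity 𝕜 H) {s : Set ℝ≥0} (hs : MeasurableSet s)
    (f : H) : 0 ≤ RCLike.re (inner 𝕜 f (E.proj s f)) := by
  have hp := E.isStarProjection s hs
  have h1 : E.proj s (E.proj s f) = E.proj s f := by
    have := congrArg (fun T : H →L[𝕜] H => T f) hp.isIdempotentElem.eq
    simpa using this
  have h2 := (ContinuousLinearMap.isSelfAdjoint_iff_isSymmetric.1 hp.isSelfAdjoint) f (E.proj s f)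
  have h3 : inner 𝕜 f (E.proj s f) = inner 𝕜 (E.proj s f) (E.proj s f) := by
    have h2' : inner 𝕜 (E.proj s f) (E.proj s f) = inner 𝕜 f (E.proj s (E.proj s f)) := h2
    rw [h2', h1]
  rw [h3]
  exact inner_self_nonneg

/-- The scalar spectral measure `d(E_λ f, f)`, that is, `s ↦ (E(s) f, f)` on Borel sets `s`. -/
def measure (E : ResolutionOfIdentity 𝕜 H) (f : H) : Measure ℝ≥0 :=
  Measure.ofMeasurable (fun s _ => ENNReal.ofReal (RCLike.re (inner 𝕜 f (E.proj s f))))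
    (by simp [E.proj_empty_apply f])
    (by
      intro s hs hd
      have h : HasSum (fun i => RCLike.re (inner 𝕜 f (E.proj (s i) f)))
          (RCLike.re (inner 𝕜 f (E.proj (⋃ i, s i) f))) :=
        RCLike.hasSum_re 𝕜 ((E.hasSum_iUnion s hs hd f).mapL (innerSL 𝕜 f))
      rw [← h.tsum_eq]
      exact ENNReal.ofReal_tsum_of_nonneg (fun i => E.inner_proj_nonneg (hs i) f) h.summable)

/-- The trivial resolution of the identity, concentrated at `0`. -/
instance : Inhabited (ResolutionOfIdentity 𝕜 H) where
  default :=
    { proj := fun s => open Classical in if (0 : ℝ≥0) ∈ s then 1 else 0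
      isStarProjection := by
        intro s _
        split_ifs
        · exact IsStarProjection.one _
        · exact IsStarProjection.zero _
      proj_univ := by simp
      hasSum_iUnion := by
        classical
        intro s _ hd f
        by_cases h : (0 : ℝ≥0) ∈ ⋃ i, s i
        · obtain ⟨i, hi⟩ := Set.mem_iUnion.1 h
          rw [if_pos h]
          have := hasSum_ite_eq i ((1 : H →L[𝕜] H) f)
          refine this.congr_fun ?_
          intro j
          by_cases hj : j = i
          · subst hj; simp [hi]
          · have : (0 : ℝ≥0) ∉ s j := fun h0 => (Set.disjoint_left.1 (hd hj) h0) hi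
            simp [hj, this]
        · rw [if_neg h]
          have h' : ∀ i, (0 : ℝ≥0) ∉ s i := fun i hi => h (Set.mem_iUnion.2 ⟨i, hi⟩)
          simp [h', hasSum_zero] }

/-- `A = ∫_0^∞ λ dE_λ`, for a symmetric operator `A`: the domain of `A` is
`{f | ∫ λ² d(E_λ f, f) < ∞}`, and `(A f, f) = ∫ λ d(E_λ f, f)` on it. -/
def Represents (E : ResolutionOfIdentity 𝕜 H) (A : H →ₗ.[𝕜] H) : Prop :=
  (∀ f : H, f ∈ A.domain ↔ ∫⁻ l : ℝ≥0, (l : ℝ≥0∞) ^ 2 ∂(E.measure f) < ∞) ∧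
  ∀ f : A.domain, inner 𝕜 (A f) (f : H) = ((∫ l : ℝ≥0, (l : ℝ) ∂(E.measure f) : ℝ) : 𝕜)

open Classical in
/-- The bounded operator `∫ g(λ) dE_λ` for a bounded Borel function `g`: the self-adjoint operator
`T` such that `(T f, f) = ∫ g(λ) d(E_λ f, f)` for all `f`. -/
def integral (E : ResolutionOfIdentity 𝕜 H) (g : ℝ≥0 → ℝ) : H →L[𝕜] H :=
  if h : ∃ T : H →L[𝕜] H, IsSelfAdjoint T ∧
      ∀ f : H, inner 𝕜 (T f) f = ((∫ l : ℝ≥0, g l ∂(E.measure f) : ℝ) : 𝕜)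
  then h.choose else 0

end ResolutionOfIdentity

section Operators

variable {𝕜 H : Type*} [RCLike 𝕜] [NormedAddCommGroup H] [InnerProductSpace 𝕜 H] [CompleteSpace H]

/-- A non-negative self-adjoint (possibly unbounded) operator. -/
def IsNonnegSelfAdjoint (A : H →ₗ.[𝕜] H) : Prop :=
  IsSelfAdjoint A ∧ ∀ f : A.domain, 0 ≤ RCLike.re (inner 𝕜 (A f) (f : H))

open Classical in
/-- The spectral resolution `E` of a non-negative self-adjoint operator `A = ∫_0^∞ λ dE_λ`. -/
def spectralResolution (A : H →ₗ.[𝕜] H) : ResolutionOfIdentity 𝕜 H :=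
  if h : ∃ E : ResolutionOfIdentity 𝕜 H, E.Represents A then h.choose else default

/-- The semigroup `T_t = e^{-tA} = ∫_0^∞ e^{-tλ} dE_λ`. -/
def heatSemigroup (A : H →ₗ.[𝕜] H) (t : ℝ) : H →L[𝕜] H :=
  (spectralResolution A).integral (fun l => Real.exp (-t * l))

/-- The domain `{f | ∫_0^∞ λ^{2α} d(E_λ f, f) < ∞}` of the fractional power `A^α`, `α > 0`. -/
def fracPowDomain (A : H →ₗ.[𝕜] H) (α : ℝ) : Set H :=
  {f | ∫⁻ l : ℝ≥0, (l : ℝ≥0∞) ^ (2 * α) ∂((spectralResolution A).measure f) < ∞}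

/-- The quadratic form `(A^α f, f) = ∫_0^∞ λ^α d(E_λ f, f)` of the fractional power `A^α`,
for `f` in the domain of `A^α`. -/
def fracPowForm (A : H →ₗ.[𝕜] H) (α : ℝ) (f : H) : ℝ :=
  ∫ l : ℝ≥0, (l : ℝ) ^ α ∂((spectralResolution A).measure f)

end Operators

end

/-! Follow `f` along the Poisson semigroup `P_s = e^{-s√A}`. With `μ_f` the spectral measure of `f`,
put `u(s) = ∫ e^{-s√λ} dμ_f = ‖P_{s/2} f‖²`, `v = u' = -∫ √λ e^{-s√λ} dμ_f` and `w = u'' = ∫ λ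
e^{-s√λ} dμ_f = (A h, h)`, where `h = P_{s/2} f`. Then `u(0+) = N = ‖f‖²` and `-K ≤ v ≤ 0`, where `K
= (A^{1/2} f, f)`.

If `P_s` contracts `L¹`, then `‖h‖₁ ≤ 1`, and the Nash inequality, which extends to the unit ball of
`L¹` by scaling and monotonicity of `B` (`nash_of_eLpNorm_le_one`), gives `u'' ≥ u B(u) ≥ β u` with
`β = B(εN)`, as long as `u ≥ εN`. Hence `v² - βu²` decreases until the time when `u = εN`. Comparing
its values there and near `0` yields `K² - βN² ≥ -βε²N²`, which is the square of the claim
(`mul_sq_le_sq_of_hasDerivAt`).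

The `L¹` contractivity of `P_s` is inherited from `T_t` (`exp_neg_sqrt`). Functions `0 ≤ g ≤ 1`
whose operators contract `L¹` are stable under products, convex combinations and pointwise limits,
hence under `g ↦ 1 - √(1 - g)` and `g ↦ e^{c(g-1)}`; applied to `e^{-rλ}` with `r → 0` and `c =
t/√r`, these give `e^{-t√λ}` in the limit.

`spectralResolution` and `integral` are defined by choice, so all this needs the spectral theorem
(`exists_represents`). The resolvent `R = (1 + A)⁻¹` satisfies `0 ≤ R ≤ 1`; its spectral measures on
`[0, 1]` come from compressions to finite-dimensional spaces and weak compactness. A calculus on a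
dense algebra of functions extends to all bounded measurable functions, and its spectral projections
are carried to `[0, ∞)` by `x ↦ 1/x - 1`. -/

/-! ### Extending a functional calculus from a dense algebra to `L²` functions. -/

/-- A symmetric functional calculus on a dense algebra of bounded measurable functions on `Ω`: a
ring of pairs `(a, T)` of a function and the operator it represents, together with the scalar
spectral measures. -/
structure SpectralCalculus (𝕜 H Ω : Type*) [RCLike 𝕜] [NormedAddCommGroup H]
    [InnerProductSpace 𝕜 H] [MeasurableSpace Ω] where
  alg : Subring ((Ω → ℝ) × (H →L[𝕜] H))
  measure : H → Measure Ω
  isFinite : ∀ f, IsFiniteMeasure (measure f)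
  measurable : ∀ p ∈ alg, Measurable p.1
  bounded : ∀ p ∈ alg, ∃ c : ℝ, ∀ x, |p.1 x| ≤ c
  isSymmetric : ∀ p ∈ alg, (p.2 : H →ₗ[𝕜] H).IsSymmetric
  inner_eq : ∀ p ∈ alg, ∀ f, RCLike.re (inner 𝕜 (p.2 f) f) = ∫ x, p.1 x ∂measure f
  const_mem : ∀ c : ℝ, ((fun _ => c : Ω → ℝ), (c : 𝕜) • (1 : H →L[𝕜] H)) ∈ alg
  dense : ∀ (ν : Measure Ω) [IsFiniteMeasure ν] (g : Ω → ℝ), MemLp g 2 ν → ∀ δ : ℝ≥0∞, δ ≠ 0 →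
    ∃ p ∈ alg, eLpNorm (g - p.1) 2 ν ≤ δ

theorem memLp_two_of_bounded {Ω : Type*} [MeasurableSpace Ω] (ν : Measure Ω) [IsFiniteMeasure ν]
    {g : Ω → ℝ} (hg : Measurable g) {c : ℝ} (hc : ∀ x, |g x| ≤ c) : MemLp g 2 ν :=
  MemLp.of_bound hg.aestronglyMeasurable c (Filter.Eventually.of_forall hc)

theorem enorm_eq_eLpNorm_two {Ω H : Type*} [MeasurableSpace Ω] [NormedAddCommGroup H]
    {ν : Measure Ω} {g : Ω → ℝ} (hg : MemLp g 2 ν) {v : H}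
    (h : ‖v‖ ^ 2 = ∫ x, g x ^ 2 ∂ν) : ‖v‖ₑ = eLpNorm g 2 ν := by
  rw [hg.eLpNorm_eq_integral_rpow_norm (by norm_num) (by norm_num), ← ofReal_norm]
  congr 1
  simp only [ENNReal.toReal_ofNat, Real.rpow_ofNat, Real.norm_eq_abs, sq_abs]
  rw [← h, ← Real.rpow_natCast, ← Real.rpow_mul (norm_nonneg _)]
  norm_num

theorem norm_sq_eq_of_enorm_eq {Ω H : Type*} [MeasurableSpace Ω] [NormedAddCommGroup H]
    {ν : Measure Ω} {g : Ω → ℝ} (hg : MemLp g 2 ν) {v : H}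
    (h : ‖v‖ₑ = eLpNorm g 2 ν) : ‖v‖ ^ 2 = ∫ x, g x ^ 2 ∂ν := by
  rw [hg.eLpNorm_eq_integral_rpow_norm (by norm_num) (by norm_num), ← ofReal_norm,
    ENNReal.ofReal_eq_ofReal_iff (norm_nonneg _) (by positivity)] at h
  simp only [ENNReal.toReal_ofNat, Real.rpow_ofNat, Real.norm_eq_abs, sq_abs] at h
  rw [h, ← Real.rpow_natCast, ← Real.rpow_mul (integral_nonneg fun x => sq_nonneg _)]
  norm_num

theorem ENNReal.tendsto_one_div_two_pow :
    Filter.Tendsto (fun n : ℕ => (1 : ℝ≥0∞) / 2 ^ n) Filter.atTop (nhds 0) := by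
  simp only [one_div, ENNReal.inv_pow]
  exact ENNReal.tendsto_pow_atTop_nhds_zero_of_lt_one
    (by rw [ENNReal.inv_lt_one]; exact ENNReal.one_lt_two)

namespace SpectralCalculus

variable {𝕜 H Ω : Type*} [RCLike 𝕜] [NormedAddCommGroup H] [InnerProductSpace 𝕜 H]
  [MeasurableSpace Ω] (C : SpectralCalculus 𝕜 H Ω)

instance (f : H) : IsFiniteMeasure (C.measure f) := C.isFinite f

theorem memLp {p : (Ω → ℝ) × (H →L[𝕜] H)} (hp : p ∈ C.alg) (ν : Measure Ω) [IsFiniteMeasure ν] :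
    MemLp p.1 2 ν :=
  let ⟨_, hc⟩ := C.bounded p hp
  memLp_two_of_bounded ν (C.measurable p hp) hc

theorem enorm_apply {p : (Ω → ℝ) × (H →L[𝕜] H)} (hp : p ∈ C.alg) (f : H) :
    ‖p.2 f‖ₑ = eLpNorm p.1 2 (C.measure f) := by
  refine enorm_eq_eLpNorm_two (C.memLp hp _) ?_
  have h := C.inner_eq _ (C.alg.mul_mem hp hp) f
  have h2 : inner 𝕜 ((p * p).2 f) f = inner 𝕜 (p.2 f) (p.2 f) := C.isSymmetric p hp (p.2 f) f
  rw [h2, inner_self_eq_norm_sq] at h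
  simpa [sq] using h

/-- `v` is the value at `f` of the operator represented by `g`. -/
def IsValue (g : Ω → ℝ) (f v : H) : Prop :=
  ∀ p ∈ C.alg, ‖v - p.2 f‖ₑ = eLpNorm (g - p.1) 2 (C.measure f)

theorem isValue_of_mem {p : (Ω → ℝ) × (H →L[𝕜] H)} (hp : p ∈ C.alg) (f : H) :
    C.IsValue p.1 f (p.2 f) := fun _ hq => C.enorm_apply (C.alg.sub_mem hp hq) f

variable {C}

/-- `IsValue` only tests against the algebra. An element of the algebra within `δ/2` of `g` serves
as intermediary for both inequalities, so the calculus at `f` is an isometry on all of `L²` of the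
spectral measure. -/
theorem IsValue.enorm_sub {g h : Ω → ℝ} {f v w : H} (hv : C.IsValue g f v) (hw : C.IsValue h f w)
    (hg : MemLp g 2 (C.measure f)) (hh : MemLp h 2 (C.measure f)) :
    ‖v - w‖ₑ = eLpNorm (g - h) 2 (C.measure f) := by
  have key : ∀ δ : ℝ≥0, 0 < δ → ∃ p ∈ C.alg, eLpNorm (g - p.1) 2 (C.measure f) ≤ δ / 2 := by
    intro δ hδ
    exact C.dense _ g hg _ (by simpa using hδ.ne')
  have half (δ : ℝ≥0) (x : ℝ≥0∞) : (δ : ℝ≥0∞) / 2 + (δ / 2 + x) = x + δ := by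
    rw [← add_assoc, ENNReal.add_halves, add_comm]
  apply le_antisymm
  · refine ENNReal.le_of_forall_pos_le_add fun δ hδ _ => ?_
    obtain ⟨p, hp, hpδ⟩ := key δ hδ
    have hpm := C.memLp hp (C.measure f)
    calc ‖v - w‖ₑ = ‖(v - p.2 f) - (w - p.2 f)‖ₑ := by congr 1; abel
      _ ≤ ‖v - p.2 f‖ₑ + ‖w - p.2 f‖ₑ := enorm_sub_le
      _ = eLpNorm (g - p.1) 2 (C.measure f) + eLpNorm (h - p.1) 2 (C.measure f) := by
          rw [hv p hp, hw p hp]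
      _ = eLpNorm (g - p.1) 2 (C.measure f)
            + eLpNorm ((g - p.1) - (g - h)) 2 (C.measure f) := by
          congr 2; abel
      _ ≤ eLpNorm (g - p.1) 2 (C.measure f) + (eLpNorm (g - p.1) 2 (C.measure f)
            + eLpNorm (g - h) 2 (C.measure f)) := by
          gcongr
          exact eLpNorm_sub_le (hg.sub hpm).1 (hg.sub hh).1 (by norm_num)
      _ ≤ δ / 2 + (δ / 2 + eLpNorm (g - h) 2 (C.measure f)) := by gcongr
      _ = _ := half _ _
  · refine ENNReal.le_of_forall_pos_le_add fun δ hδ _ => ?_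
    obtain ⟨p, hp, hpδ⟩ := key δ hδ
    have hpm := C.memLp hp (C.measure f)
    calc eLpNorm (g - h) 2 (C.measure f)
        = eLpNorm ((g - p.1) - (h - p.1)) 2 (C.measure f) := by congr 1; abel
      _ ≤ eLpNorm (g - p.1) 2 (C.measure f) + eLpNorm (h - p.1) 2 (C.measure f) :=
          eLpNorm_sub_le (hg.sub hpm).1 (hh.sub hpm).1 (by norm_num)
      _ = ‖v - p.2 f‖ₑ + ‖(v - p.2 f) - (v - w)‖ₑ := by
          rw [hv p hp, ← hw p hp]; congr 2; abel
      _ ≤ ‖v - p.2 f‖ₑ + (‖v - p.2 f‖ₑ + ‖v - w‖ₑ) := by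
          gcongr
          exact enorm_sub_le
      _ ≤ δ / 2 + (δ / 2 + ‖v - w‖ₑ) := by rw [hv p hp]; gcongr
      _ = _ := half _ _

theorem IsValue.unique {g h : Ω → ℝ} {f v w : H} (hv : C.IsValue g f v) (hw : C.IsValue h f w)
    (hg : MemLp g 2 (C.measure f)) (hgh : g =ᵐ[C.measure f] h) : v = w := by
  have h1 := hv.enorm_sub hw hg ((memLp_congr_ae hgh).1 hg)
  rw [eLpNorm_congr_ae (g := 0) (by filter_upwards [hgh] with x hx; simp [hx])] at h1
  simpa [sub_eq_zero] using h1

variable (C)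

/-- The calculus is isometric on the algebra, so approximants of `g` in `L²` give a Cauchy sequence
in `H`, whose limit is the value. -/
theorem exists_isValue [CompleteSpace H] {g : Ω → ℝ} {f : H} (hg : MemLp g 2 (C.measure f)) :
    ∃ v, C.IsValue g f v := by
  have key : ∀ n : ℕ, ∃ p ∈ C.alg, eLpNorm (g - p.1) 2 (C.measure f) ≤ 1 / 2 ^ n := by
    intro n
    exact C.dense _ g hg _ (by simp)
  choose p hp hpn using key
  have hm n := C.memLp (hp n) (C.measure f)
  have hpn' : ∀ n, eLpNorm ((p n).1 - g) 2 (C.measure f) ≤ 1 / 2 ^ n := by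
    intro n; rw [eLpNorm_sub_comm]; exact hpn n
  have hlim := ENNReal.tendsto_one_div_two_pow
  have hcau : CauchySeq fun n => (p n).2 f := by
    refine cauchySeq_of_edist_le_geometric_two 2 (by norm_num) fun n => ?_
    rw [edist_eq_enorm_sub]
    have h1 : ‖(p n).2 f - (p (n + 1)).2 f‖ₑ
        = eLpNorm (((p n).1 - g) - ((p (n + 1)).1 - g)) 2 (C.measure f) := by
      rw [sub_sub_sub_cancel_right]
      exact C.enorm_apply (C.alg.sub_mem (hp n) (hp (n + 1))) f
    rw [h1]
    refine (eLpNorm_sub_le ((hm n).sub hg).1 ((hm _).sub hg).1 (by norm_num)).trans ?_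
    have h2 : (1 : ℝ≥0∞) / 2 ^ (n + 1) ≤ 1 / 2 ^ n := by
      gcongr
      · norm_num
      · simp
    calc _ ≤ (1 : ℝ≥0∞) / 2 ^ n + 1 / 2 ^ n := add_le_add (hpn' n) ((hpn' _).trans h2)
      _ = 2 / 2 ^ n := by rw [ENNReal.div_add_div_same]; norm_num
  obtain ⟨v, hv⟩ := cauchySeq_tendsto_of_complete hcau
  refine ⟨v, fun q hq => ?_⟩
  have hqm := C.memLp hq (C.measure f)
  have hl : Filter.Tendsto (fun n => ‖(p n).2 f - q.2 f‖ₑ) Filter.atTop (nhds ‖v - q.2 f‖ₑ) :=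
    (hv.sub_const _).enorm
  have he : ∀ n, ‖(p n).2 f - q.2 f‖ₑ = eLpNorm ((p n).1 - q.1) 2 (C.measure f) :=
    fun n => C.enorm_apply (C.alg.sub_mem (hp n) hq) f
  apply le_antisymm
  · have h3 : Filter.Tendsto (fun n : ℕ => (1 : ℝ≥0∞) / 2 ^ n + eLpNorm (g - q.1) 2 (C.measure f))
        Filter.atTop (nhds (0 + eLpNorm (g - q.1) 2 (C.measure f))) := hlim.add_const _
    rw [zero_add] at h3
    refine le_of_tendsto_of_tendsto' hl h3 fun n => ?_
    rw [he, ← sub_add_sub_cancel _ g]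
    exact (eLpNorm_add_le ((hm n).sub hg).1 (hg.sub hqm).1 (by norm_num)).trans
      (add_le_add_left (hpn' n) _)
  · have h3 := hlim.add hl
    rw [zero_add] at h3
    refine ge_of_tendsto' h3 fun n => ?_
    rw [he, ← sub_add_sub_cancel _ (p n).1]
    exact (eLpNorm_add_le (hg.sub (hm n)).1 ((hm n).sub hqm).1 (by norm_num)).trans
      (add_le_add_left (hpn n) _)

end SpectralCalculus

/-- Bounded measurable real functions. -/
def BoundedMeasurable {Ω : Type*} [MeasurableSpace Ω] (g : Ω → ℝ) : Prop :=
  Measurable g ∧ ∃ c : ℝ, ∀ x, |g x| ≤ c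

namespace BoundedMeasurable

variable {Ω : Type*} [MeasurableSpace Ω] {g h : Ω → ℝ}

theorem memLp (hg : BoundedMeasurable g) (ν : Measure Ω) [IsFiniteMeasure ν] : MemLp g 2 ν :=
  let ⟨_, hc⟩ := hg.2
  memLp_two_of_bounded ν hg.1 hc

theorem add (hg : BoundedMeasurable g) (hh : BoundedMeasurable h) : BoundedMeasurable (g + h) := by
  obtain ⟨c, hc⟩ := hg.2
  obtain ⟨d, hd⟩ := hh.2
  exact ⟨hg.1.add hh.1, c + d, fun x => (abs_add_le _ _).trans (add_le_add (hc x) (hd x))⟩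

theorem mul (hg : BoundedMeasurable g) (hh : BoundedMeasurable h) : BoundedMeasurable (g * h) := by
  obtain ⟨c, hc⟩ := hg.2
  obtain ⟨d, hd⟩ := hh.2
  refine ⟨hg.1.mul hh.1, c * d, fun x => ?_⟩
  rw [Pi.mul_apply, abs_mul]
  exact mul_le_mul (hc x) (hd x) (abs_nonneg _) ((abs_nonneg _).trans (hc x))

theorem const (c : ℝ) : BoundedMeasurable (fun _ : Ω => c) := ⟨measurable_const, |c|, fun _ => le_rfl⟩

theorem indicator {s : Set Ω} (hs : MeasurableSet s) :
    BoundedMeasurable (s.indicator (1 : Ω → ℝ)) := by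
  refine ⟨measurable_one.indicator hs, 1, fun x => ?_⟩
  by_cases hx : x ∈ s <;> simp [hx]

end BoundedMeasurable

theorem eLpNorm_mul_le_of_abs_le {Ω : Type*} [MeasurableSpace Ω] (ν : Measure Ω) {g : Ω → ℝ} {c : ℝ}
    (hc : ∀ x, |g x| ≤ c) (h : Ω → ℝ) : eLpNorm (g * h) 2 ν ≤ ENNReal.ofReal c * eLpNorm h 2 ν :=
  eLpNorm_le_mul_eLpNorm_of_ae_le_mul (Filter.Eventually.of_forall fun x => by
    rw [Pi.mul_apply, norm_mul]
    exact mul_le_mul_of_nonneg_right (hc x) (norm_nonneg _)) 2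

namespace SpectralCalculus

variable {𝕜 H Ω : Type*} [RCLike 𝕜] [NormedAddCommGroup H] [InnerProductSpace 𝕜 H]
  [MeasurableSpace Ω] (C : SpectralCalculus 𝕜 H Ω)

/-- The measure `ν` can dominate the spectral measures of several vectors at once. One sequence of
operators then converges at all of them, which lets linearity and symmetry pass to the limit. -/
theorem exists_seq (ν : Measure Ω) [IsFiniteMeasure ν] {g : Ω → ℝ} (hg : MemLp g 2 ν) :
    ∃ p : ℕ → (Ω → ℝ) × (H →L[𝕜] H), (∀ n, p n ∈ C.alg) ∧
      Filter.Tendsto (fun n => eLpNorm (g - (p n).1) 2 ν) Filter.atTop (nhds 0) ∧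
      ∀ f v, C.measure f ≤ ν → C.IsValue g f v →
        Filter.Tendsto (fun n => (p n).2 f) Filter.atTop (nhds v) := by
  have key : ∀ n : ℕ, ∃ p ∈ C.alg, eLpNorm (g - p.1) 2 ν ≤ 1 / 2 ^ n := by
    intro n
    exact C.dense _ g hg _ (by simp)
  choose p hp hpn using key
  have hlim := ENNReal.tendsto_one_div_two_pow
  have hlim' := tendsto_of_tendsto_of_tendsto_of_le_of_le tendsto_const_nhds hlim
    (fun _ => zero_le) hpn
  refine ⟨p, hp, hlim', fun f v hf hv => ?_⟩
  rw [tendsto_iff_edist_tendsto_0]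
  refine tendsto_of_tendsto_of_tendsto_of_le_of_le tendsto_const_nhds hlim'
    (fun _ => zero_le) fun n => ?_
  dsimp only
  rw [edist_comm, edist_eq_enorm_sub, hv _ (hp n)]
  exact eLpNorm_mono_measure _ hf

/-- `T` is the bounded operator represented by `g`. -/
def IsOp (g : Ω → ℝ) (T : H →L[𝕜] H) : Prop := ∀ f, C.IsValue g f (T f)

theorem isOp_of_mem {p : (Ω → ℝ) × (H →L[𝕜] H)} (hp : p ∈ C.alg) : C.IsOp p.1 p.2 :=
  fun f => C.isValue_of_mem hp f

variable {C}

theorem inner_value_comm {g : Ω → ℝ} {f f' v v' : H} (hv : C.IsValue g f v)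
    (hv' : C.IsValue g f' v') (hg : BoundedMeasurable g) : inner 𝕜 v f' = inner 𝕜 f v' := by
  obtain ⟨p, hp, -, hpl⟩ := C.exists_seq (C.measure f + C.measure f') (hg.memLp _)
  have h1 := hpl f v (Measure.le_add_right le_rfl) hv
  have h2 := hpl f' v' (Measure.le_add_left le_rfl) hv'
  refine tendsto_nhds_unique (h1.inner (𝕜 := 𝕜) (tendsto_const_nhds (x := f')))
    ((tendsto_const_nhds (x := f)).inner h2 |>.congr fun n => ?_)
  exact (C.isSymmetric _ (hp n) f f').symm

variable (C)

theorem exists_isOp [CompleteSpace H] {g : Ω → ℝ} (hg : BoundedMeasurable g) :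
    ∃ T : H →L[𝕜] H, C.IsOp g T := by
  choose v hv using fun f => C.exists_isValue (f := f) (hg.memLp _)
  let L : H →ₗ[𝕜] H :=
    { toFun := v
      map_add' := fun f f' => by
        obtain ⟨p, hp, -, hpl⟩ := C.exists_seq
          (C.measure f + C.measure f' + C.measure (f + f')) (hg.memLp _)
        have h1 := hpl f _ (Measure.le_add_right (Measure.le_add_right le_rfl)) (hv f)
        have h2 := hpl f' _ (Measure.le_add_right (Measure.le_add_left le_rfl)) (hv f')
        have h3 := hpl (f + f') _ (Measure.le_add_left le_rfl) (hv _)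
        exact tendsto_nhds_unique h3 ((h1.add h2).congr fun n => (map_add _ _ _).symm)
      map_smul' := fun c f => by
        obtain ⟨p, hp, -, hpl⟩ := C.exists_seq (C.measure f + C.measure (c • f)) (hg.memLp _)
        have h1 := hpl f _ (Measure.le_add_right le_rfl) (hv f)
        have h2 := hpl (c • f) _ (Measure.le_add_left le_rfl) (hv _)
        exact tendsto_nhds_unique h2 ((h1.const_smul c).congr fun n => (map_smul _ _ _).symm) }
  -- An everywhere defined symmetric operator on a Hilbert space is continuous (Hellinger–Toeplitz),
  -- so no norm estimate is needed.
  have hL : L.IsSymmetric := fun f f' => inner_value_comm (hv f) (hv f') hg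
  exact ⟨⟨L, hL.continuous⟩, hv⟩

variable {C}

theorem IsOp.isSymmetric {g : Ω → ℝ} {T : H →L[𝕜] H} (hT : C.IsOp g T)
    (hg : BoundedMeasurable g) : (T : H →ₗ[𝕜] H).IsSymmetric :=
  fun f f' => inner_value_comm (hT f) (hT f') hg

theorem IsOp.isValue_apply [CompleteSpace H] {g : Ω → ℝ} {T : H →L[𝕜] H} (hT : C.IsOp g T)
    (hg : BoundedMeasurable g) {p : (Ω → ℝ) × (H →L[𝕜] H)} (hp : p ∈ C.alg) (f : H) :
    C.IsValue (g * p.1) f (T (p.2 f)) := by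
  have hpb : BoundedMeasurable p.1 := ⟨C.measurable p hp, C.bounded p hp⟩
  obtain ⟨w, hw⟩ := C.exists_isValue (f := f) ((hg.mul hpb).memLp _)
  -- Nothing is known yet about how the spectral measures of `f` and `p.2 f` are related, so the
  -- approximation is made in both.
  obtain ⟨q, hq, hq0, hql⟩ := C.exists_seq (C.measure f + C.measure (p.2 f)) (hg.memLp _)
  have h1 := hql (p.2 f) _ (Measure.le_add_left le_rfl) (hT _)
  suffices h2 : Filter.Tendsto (fun n => (q n).2 (p.2 f)) Filter.atTop (nhds w) by
    rwa [tendsto_nhds_unique h1 h2]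
  rw [tendsto_iff_edist_tendsto_0]
  obtain ⟨c, hc⟩ := hpb.2
  have h0 : Filter.Tendsto (fun n => ENNReal.ofReal c *
      eLpNorm (g - (q n).1) 2 (C.measure f + C.measure (p.2 f))) Filter.atTop (nhds 0) := by
    simpa using ENNReal.Tendsto.const_mul hq0 (Or.inr (ENNReal.ofReal_ne_top (r := c)))
  refine tendsto_of_tendsto_of_tendsto_of_le_of_le tendsto_const_nhds h0
    (fun _ => zero_le) fun n => ?_
  dsimp only
  have h3 := hw _ (C.alg.mul_mem (hq n) hp)
  rw [edist_comm, edist_eq_enorm_sub]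
  refine h3.trans_le ?_
  rw [Prod.fst_mul, ← sub_mul, mul_comm]
  refine (eLpNorm_mul_le_of_abs_le _ hc _).trans ?_
  gcongr
  exact Measure.le_add_right le_rfl

theorem IsOp.isValue_mul [CompleteSpace H] {g h : Ω → ℝ} {T : H →L[𝕜] H} (hT : C.IsOp g T)
    (hg : BoundedMeasurable g) {f v : H} (hv : C.IsValue h f v) (hh : MemLp h 2 (C.measure f)) :
    C.IsValue (g * h) f (T v) := by
  obtain ⟨c, hc⟩ := hg.2
  have hgh : MemLp (g * h) 2 (C.measure f) :=
    MemLp.of_le_mul (c := c) hh (hg.1.aestronglyMeasurable.mul hh.1) (Filter.Eventually.of_forall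
      fun x => by
        rw [Pi.mul_apply, norm_mul]
        exact mul_le_mul_of_nonneg_right (hc x) (norm_nonneg _))
  obtain ⟨w, hw⟩ := C.exists_isValue (f := f) hgh
  obtain ⟨q, hq, hq0, hql⟩ := C.exists_seq (C.measure f) hh
  have h1 := (T.continuous.tendsto _).comp (hql f _ le_rfl hv)
  suffices h2 : Filter.Tendsto (T ∘ fun n => (q n).2 f) Filter.atTop (nhds w) by
    rwa [tendsto_nhds_unique h1 h2]
  rw [tendsto_iff_edist_tendsto_0]
  have h0 : Filter.Tendsto (fun n => ENNReal.ofReal c *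
      eLpNorm (h - (q n).1) 2 (C.measure f)) Filter.atTop (nhds 0) := by
    simpa using ENNReal.Tendsto.const_mul hq0 (Or.inr (ENNReal.ofReal_ne_top (r := c)))
  refine tendsto_of_tendsto_of_tendsto_of_le_of_le tendsto_const_nhds h0
    (fun _ => zero_le) fun n => ?_
  dsimp only [Function.comp]
  have hqb : BoundedMeasurable (q n).1 := ⟨C.measurable _ (hq n), C.bounded _ (hq n)⟩
  rw [edist_comm, edist_eq_enorm_sub, hw.enorm_sub (hT.isValue_apply hg (hq n) f) hgh
    ((hg.mul hqb).memLp _), ← mul_sub]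
  exact eLpNorm_mul_le_of_abs_le _ hc _

theorem IsOp.mul [CompleteSpace H] {g h : Ω → ℝ} {T S : H →L[𝕜] H} (hT : C.IsOp g T)
    (hS : C.IsOp h S) (hg : BoundedMeasurable g) (hh : BoundedMeasurable h) :
    C.IsOp (g * h) (T * S) := fun f => hT.isValue_mul hg (hS f) (hh.memLp _)

/-- For `q` in the algebra close to `g`, the difference `p - q` is again in the algebra, so testing
`S` against it approximates testing `T + S` against `p`. -/
theorem IsOp.add {g h : Ω → ℝ} {T S : H →L[𝕜] H} (hT : C.IsOp g T)
    (hS : C.IsOp h S) (hg : BoundedMeasurable g) (hh : BoundedMeasurable h) :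
    C.IsOp (g + h) (T + S) := by
  intro f p hp
  obtain ⟨q, hq, hq0, hql⟩ := C.exists_seq (C.measure f) (hg.memLp _)
  have hm n := C.memLp (hq n) (C.measure f)
  have hpm := C.memLp hp (C.measure f)
  have h1 := hql f _ le_rfl (hT f)
  have h3 n : ‖S f + (q n).2 f - p.2 f‖ₑ = eLpNorm (h - (p.1 - (q n).1)) 2 (C.measure f) := by
    rw [← sub_sub_eq_add_sub]
    exact hS f _ (C.alg.sub_mem hp (hq n))
  have h2 : Filter.Tendsto (fun n => eLpNorm (h - (p.1 - (q n).1)) 2 (C.measure f)) Filter.atTop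
      (nhds ‖(T + S) f - p.2 f‖ₑ) := by
    simp only [← h3]
    rw [add_apply, add_comm (T f)]
    exact ((h1.const_add (S f)).sub_const (p.2 f)).enorm
  have h4 := hq0.add h2
  have h5 := hq0.add_const (eLpNorm (g + h - p.1) 2 (C.measure f))
  rw [zero_add] at h4 h5
  have hgm := hg.memLp (C.measure f)
  have hhm := hh.memLp (C.measure f)
  apply le_antisymm
  · refine le_of_tendsto_of_tendsto' h2 h5 fun n => ?_
    have e : h - (p.1 - (q n).1) = (g + h - p.1) - (g - (q n).1) := by
      ext x; simp only [Pi.sub_apply, Pi.add_apply]; ring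
    rw [e]
    exact (eLpNorm_sub_le ((hgm.add hhm).sub hpm).1 (hgm.sub (hm n)).1 (by norm_num)).trans_eq
      (add_comm _ _)
  · refine ge_of_tendsto' h4 fun n => ?_
    have e : g + h - p.1 = (g - (q n).1) + (h - (p.1 - (q n).1)) := by
      ext x; simp only [Pi.sub_apply, Pi.add_apply]; ring
    rw [e]
    exact eLpNorm_add_le (hgm.sub (hm n)).1 (hhm.sub (hpm.sub (hm n))).1 (by norm_num)

variable (C)

theorem isOp_const (c : ℝ) : C.IsOp (fun _ => c) ((c : 𝕜) • 1) := C.isOp_of_mem (C.const_mem c)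

variable {C}

theorem IsOp.enorm_sub {g h : Ω → ℝ} {T S : H →L[𝕜] H} (hT : C.IsOp g T)
    (hS : C.IsOp h S) (hg : BoundedMeasurable g) (hh : BoundedMeasurable h) (f : H) :
    ‖T f - S f‖ₑ = eLpNorm (g - h) 2 (C.measure f) :=
  (hT f).enorm_sub (hS f) (hg.memLp _) (hh.memLp _)

theorem IsOp.unique {g : Ω → ℝ} {T S : H →L[𝕜] H} (hT : C.IsOp g T) (hS : C.IsOp g S)
    (hg : BoundedMeasurable g) : T = S :=
  ContinuousLinearMap.ext fun f => (hT f).unique (hS f) (hg.memLp _) Filter.EventuallyEq.rfl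

theorem norm_sq_eq_measure_univ (f : H) : ‖f‖ ^ 2 = (C.measure f).real Set.univ := by
  have := C.inner_eq _ (C.const_mem 1) f
  rw [← inner_self_eq_norm_sq (𝕜 := 𝕜)]
  simpa using this

theorem IsValue.norm_sq {g : Ω → ℝ} {f v : H} (hv : C.IsValue g f v)
    (hg : MemLp g 2 (C.measure f)) : ‖v‖ ^ 2 = ∫ x, g x ^ 2 ∂C.measure f := by
  refine norm_sq_eq_of_enorm_eq hg ?_
  simpa using hv 0 C.alg.zero_mem

/-- Polarization against the constant function `1`, whose value at `f` is `f`: expand `‖v - f‖²` in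
`H` and in `L²`. -/
theorem IsValue.inner_eq {g : Ω → ℝ} {f v : H} (hv : C.IsValue g f v)
    (hg : MemLp g 2 (C.measure f)) :
    RCLike.re (inner 𝕜 v f) = ∫ x, g x ∂C.measure f := by
  have h1 := hv.norm_sq hg
  have h2 := norm_sq_eq_of_enorm_eq (hg.sub (C.memLp (C.const_mem 1) _)) (hv _ (C.const_mem 1))
  have hi : Integrable g (C.measure f) := hg.integrable (by norm_num)
  have h3 : ∫ x, (g - fun _ => (1 : ℝ) : Ω → ℝ) x ^ 2 ∂C.measure f
      = ∫ x, g x ^ 2 ∂C.measure f - 2 * ∫ x, g x ∂C.measure f + (C.measure f).real Set.univ := by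
    rw [show (C.measure f).real Set.univ = ∫ _, (1 : ℝ) ∂C.measure f by simp,
      ← integral_const_mul, ← integral_sub hg.integrable_sq (hi.const_mul 2),
      ← integral_add (f := fun x => g x ^ 2 - 2 * g x) (hg.integrable_sq.sub (hi.const_mul 2))
        (integrable_const _)]
    refine integral_congr_ae (Filter.Eventually.of_forall fun x => ?_)
    simp only [Pi.sub_apply]
    ring
  have h4 : ‖v - f‖ ^ 2 = ‖v‖ ^ 2 - 2 * RCLike.re (inner 𝕜 v f) + ‖f‖ ^ 2 := norm_sub_sq v f
  have h5 : ((1 : ℝ) : 𝕜) • (1 : H →L[𝕜] H) = 1 := by simp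
  simp only [h5, one_apply_eq_self] at h2
  rw [h3, h4, h1, norm_sq_eq_measure_univ (C := C)] at h2
  linarith

theorem IsOp.inner_eq {g : Ω → ℝ} {T : H →L[𝕜] H} (hT : C.IsOp g T)
    (hg : BoundedMeasurable g) (f : H) :
    inner 𝕜 (T f) f = ((∫ x, g x ∂C.measure f : ℝ) : 𝕜) := by
  rw [← (hT f).inner_eq (hg.memLp _)]
  exact ((hT.isSymmetric hg).coe_re_inner_apply_self f).symm

theorem IsOp.isStarProjection [CompleteSpace H] {s : Set Ω} (hs : MeasurableSet s)
    {P : H →L[𝕜] H} (hP : C.IsOp (s.indicator 1) P) : IsStarProjection P := by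
  have hb := BoundedMeasurable.indicator hs
  refine ⟨?_, ?_⟩
  · have h := hP.mul hP hb hb
    rw [show s.indicator (1 : Ω → ℝ) * s.indicator 1 = s.indicator 1 by
      ext x; by_cases hx : x ∈ s <;> simp [hx]] at h
    exact h.unique hP hb
  · exact ContinuousLinearMap.isSelfAdjoint_iff_isSymmetric.2 (hP.isSymmetric hb)

/-- If `P` is the spectral projection of `s`, then `C.measure v s = ‖P v‖²`, and `P v` is the value
at `f` of the indicator of `s` times `g`. -/
theorem IsValue.measure_eq [CompleteSpace H] {g : Ω → ℝ} {f v : H} (hv : C.IsValue g f v)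
    (hg : MemLp g 2 (C.measure f)) {s : Set Ω} (hs : MeasurableSet s) :
    C.measure v s = ∫⁻ x in s, ENNReal.ofReal (g x ^ 2) ∂C.measure f := by
  obtain ⟨P, hP⟩ := C.exists_isOp (BoundedMeasurable.indicator hs)
  have hb := BoundedMeasurable.indicator hs
  have h1 := (hP v).norm_sq (hb.memLp _)
  have hgs : s.indicator (1 : Ω → ℝ) * g = s.indicator g := by
    ext x; by_cases hx : x ∈ s <;> simp [hx]
  have h2 := hP.isValue_mul hb hv hg
  rw [hgs] at h2
  have h3 := h2.norm_sq (hg.indicator hs)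
  have e1 : ∀ x, s.indicator (1 : Ω → ℝ) x ^ 2 = s.indicator 1 x := fun x => by
    by_cases hx : x ∈ s <;> simp [hx]
  have e2 : ∀ x, s.indicator g x ^ 2 = s.indicator (fun x => g x ^ 2) x := fun x => by
    by_cases hx : x ∈ s <;> simp [hx]
  simp only [e1, e2] at h1 h3
  rw [integral_indicator_one hs] at h1
  rw [integral_indicator hs] at h3
  rw [← ofReal_measureReal, ← h1, h3, ofReal_integral_eq_lintegral_ofReal
    hg.integrable_sq.integrableOn (Filter.Eventually.of_forall fun x => sq_nonneg _)]

theorem IsValue.measure_eq_withDensity [CompleteSpace H] {g : Ω → ℝ} {f v : H}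
    (hv : C.IsValue g f v) (hg : MemLp g 2 (C.measure f)) :
    C.measure v = (C.measure f).withDensity fun x => ENNReal.ofReal (g x ^ 2) := by
  ext s hs
  rw [hv.measure_eq hg hs, withDensity_apply _ hs]

end SpectralCalculus

/-! ### The bounded functional calculus of a resolution of the identity. -/

namespace ResolutionOfIdentity

variable {𝕜 H : Type*} [RCLike 𝕜] [NormedAddCommGroup H] [InnerProductSpace 𝕜 H] [CompleteSpace H]
  (E : ResolutionOfIdentity 𝕜 H)

theorem proj_isSymmetric {s : Set ℝ≥0} (hs : MeasurableSet s) :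
    (E.proj s : H →ₗ[𝕜] H).IsSymmetric :=
  ContinuousLinearMap.isSelfAdjoint_iff_isSymmetric.1 (E.isStarProjection s hs).isSelfAdjoint

theorem proj_proj_self {s : Set ℝ≥0} (hs : MeasurableSet s) (f : H) :
    E.proj s (E.proj s f) = E.proj s f :=
  DFunLike.congr_fun (E.isStarProjection s hs).isIdempotentElem.eq f

theorem measure_apply (f : H) {s : Set ℝ≥0} (hs : MeasurableSet s) :
    E.measure f s = ENNReal.ofReal (RCLike.re (inner 𝕜 f (E.proj s f))) :=
  Measure.ofMeasurable_apply s hs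

theorem re_inner_proj (f : H) {s : Set ℝ≥0} (hs : MeasurableSet s) :
    RCLike.re (inner 𝕜 f (E.proj s f)) = ‖E.proj s f‖ ^ 2 := by
  rw [← inner_self_eq_norm_sq (𝕜 := 𝕜)]
  have h : inner 𝕜 (E.proj s f) (E.proj s f) = inner 𝕜 f (E.proj s (E.proj s f)) :=
    E.proj_isSymmetric hs f (E.proj s f)
  rw [h, proj_proj_self E hs]

theorem measureReal_apply (f : H) {s : Set ℝ≥0} (hs : MeasurableSet s) :
    (E.measure f).real s = ‖E.proj s f‖ ^ 2 := by
  rw [measureReal_def, E.measure_apply f hs, re_inner_proj E f hs,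
    ENNReal.toReal_ofReal (sq_nonneg _)]

instance (f : H) : IsFiniteMeasure (E.measure f) :=
  ⟨by rw [E.measure_apply f MeasurableSet.univ]; exact ENNReal.ofReal_lt_top⟩

/-- Additivity of the scalar measures says that both sides have the same quadratic form, and a
symmetric operator with zero form vanishes. -/
theorem proj_union {s t : Set ℝ≥0} (hs : MeasurableSet s) (ht : MeasurableSet t)
    (hd : Disjoint s t) : E.proj (s ∪ t) = E.proj s + E.proj t := by
  have h0 : ((E.proj (s ∪ t) - (E.proj s + E.proj t) : H →L[𝕜] H) : H →ₗ[𝕜] H) = 0 := by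
    have hsym : ((E.proj (s ∪ t) - (E.proj s + E.proj t) : H →L[𝕜] H) : H →ₗ[𝕜] H).IsSymmetric :=
      (E.proj_isSymmetric (hs.union ht)).sub ((E.proj_isSymmetric hs).add (E.proj_isSymmetric ht))
    refine hsym.inner_map_self_eq_zero.1 fun f => ?_
    rw [hsym f f, ← hsym.coe_re_inner_self_apply]
    have h := measureReal_union (μ := E.measure f) hd ht
    rw [measureReal_apply E f (hs.union ht), measureReal_apply E f hs, measureReal_apply E f ht,
      ← re_inner_proj E f hs, ← re_inner_proj E f ht, ← re_inner_proj E f (hs.union ht)] at h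
    have h' : inner 𝕜 f (((E.proj (s ∪ t) - (E.proj s + E.proj t) : H →L[𝕜] H) : H →ₗ[𝕜] H) f)
        = inner 𝕜 f (E.proj (s ∪ t) f) - (inner 𝕜 f (E.proj s f) + inner 𝕜 f (E.proj t f)) := by
      rw [← inner_add_right, ← inner_sub_right]; rfl
    rw [h', map_sub, map_add, h, sub_self, RCLike.ofReal_zero]
  ext f
  have := DFunLike.congr_fun h0 f
  exact sub_eq_zero.1 this

/-- For `g = E(s) f`, additivity gives `‖E(s) g‖² + ‖E(t) g‖² ≤ ‖g‖²`, and the first term is already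
`‖g‖²`. -/
theorem proj_proj_of_disjoint {s t : Set ℝ≥0} (hs : MeasurableSet s) (ht : MeasurableSet t)
    (hd : Disjoint s t) (f : H) : E.proj t (E.proj s f) = 0 := by
  have h1 := measureReal_union (μ := E.measure (E.proj s f)) hd ht
  have h2 : (E.measure (E.proj s f)).real (s ∪ t) ≤ (E.measure (E.proj s f)).real Set.univ :=
    measureReal_mono (Set.subset_univ _)
  rw [measureReal_apply E _ MeasurableSet.univ, E.proj_univ] at h2
  rw [measureReal_apply E _ hs, measureReal_apply E _ ht, proj_proj_self E hs] at h1
  have h3 : ‖E.proj t (E.proj s f)‖ ^ 2 ≤ 0 := by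
    have : ‖(1 : H →L[𝕜] H) (E.proj s f)‖ = ‖E.proj s f‖ := rfl
    rw [this] at h2
    linarith
  have h4 := pow_eq_zero_iff (two_ne_zero) |>.1 (le_antisymm h3 (sq_nonneg _))
  exact norm_eq_zero.1 h4

theorem proj_mul {s t : Set ℝ≥0} (hs : MeasurableSet s) (ht : MeasurableSet t) :
    E.proj s * E.proj t = E.proj (s ∩ t) := by
  ext f
  have h1 : E.proj s = E.proj (s ∩ t) + E.proj (s \ t) := by
    rw [← proj_union E (hs.inter ht) (hs.diff ht)
      (Set.disjoint_sdiff_right.mono_left Set.inter_subset_right), Set.inter_union_sdiff]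
  have h2 : f = E.proj t f + E.proj tᶜ f := by
    have h := DFunLike.congr_fun (proj_union E ht ht.compl disjoint_compl_right) f
    rw [Set.union_compl_self, E.proj_univ] at h
    exact h
  have h3 : E.proj (s \ t) (E.proj t f) = 0 :=
    proj_proj_of_disjoint E ht (hs.diff ht) Set.disjoint_sdiff_right f
  have h4 : E.proj (s ∩ t) (E.proj tᶜ f) = 0 :=
    proj_proj_of_disjoint E ht.compl (hs.inter ht)
      (disjoint_compl_left.mono_right Set.inter_subset_right) f
  calc (E.proj s * E.proj t) f = E.proj s (E.proj t f) := rfl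
    _ = E.proj (s ∩ t) (E.proj t f) + E.proj (s \ t) (E.proj t f) := by
        conv_lhs => rw [h1]
        rfl
    _ = E.proj (s ∩ t) (E.proj t f) + E.proj (s ∩ t) (E.proj tᶜ f) := by rw [h3, h4]
    _ = E.proj (s ∩ t) f := by rw [← map_add, ← h2]

/-- The pairs `(c 1_s, c E(s))`. -/
def indicatorPairs : Submonoid ((ℝ≥0 → ℝ) × (H →L[𝕜] H)) where
  carrier := {p | ∃ (c : ℝ) (s : Set ℝ≥0), MeasurableSet s ∧
    p = (s.indicator fun _ => c, (c : 𝕜) • E.proj s)}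
  one_mem' := ⟨1, Set.univ, MeasurableSet.univ, by
    rw [E.proj_univ, Set.indicator_univ, RCLike.ofReal_one, one_smul]; rfl⟩
  mul_mem' := by
    rintro _ _ ⟨c, s, hs, rfl⟩ ⟨d, t, ht, rfl⟩
    refine ⟨c * d, s ∩ t, hs.inter ht, Prod.ext ?_ ?_⟩
    · ext x
      by_cases h1 : x ∈ s <;> by_cases h2 : x ∈ t <;> simp [h1, h2]
    · rw [Prod.snd_mul, smul_mul_smul_comm, proj_mul E hs ht, RCLike.ofReal_mul]

/-- The generators are closed under products, so the properties of the calculus need only be checked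
on generators, sums and negatives. -/
theorem mem_closure_indicatorPairs_iff {p : (ℝ≥0 → ℝ) × (H →L[𝕜] H)} :
    p ∈ Subring.closure (E.indicatorPairs : Set ((ℝ≥0 → ℝ) × (H →L[𝕜] H))) ↔
      p ∈ AddSubgroup.closure (E.indicatorPairs : Set ((ℝ≥0 → ℝ) × (H →L[𝕜] H))) := by
  rw [Subring.mem_closure_iff, Submonoid.closure_eq]

theorem properties_of_mem_closure {p : (ℝ≥0 → ℝ) × (H →L[𝕜] H)}
    (hp : p ∈ Subring.closure (E.indicatorPairs : Set ((ℝ≥0 → ℝ) × (H →L[𝕜] H)))) :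
    BoundedMeasurable p.1 ∧ (p.2 : H →ₗ[𝕜] H).IsSymmetric ∧
      ∀ f, RCLike.re (inner 𝕜 (p.2 f) f) = ∫ x, p.1 x ∂E.measure f := by
  rw [mem_closure_indicatorPairs_iff] at hp
  induction hp using AddSubgroup.closure_induction with
  | mem p hp =>
    obtain ⟨c, s, hs, rfl⟩ := hp
    refine ⟨⟨measurable_const.indicator hs, |c|, fun x => ?_⟩,
      (E.proj_isSymmetric hs).smul (RCLike.conj_ofReal c), fun f => ?_⟩
    · by_cases hx : x ∈ s <;> simp [hx]
    · have h : inner 𝕜 (E.proj s f) f = inner 𝕜 f (E.proj s f) := E.proj_isSymmetric hs f f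
      rw [integral_indicator_const _ hs, measureReal_apply E f hs, ← re_inner_proj E f hs, ← h,
        smul_apply, inner_smul_left, RCLike.conj_ofReal, RCLike.re_ofReal_mul, smul_eq_mul,
        mul_comm]
  | zero => exact ⟨BoundedMeasurable.const 0, LinearMap.IsSymmetric.zero, fun f => by simp⟩
  | add p q _ _ hp hq =>
    refine ⟨hp.1.add hq.1, hp.2.1.add hq.2.1, fun f => ?_⟩
    have h1 := (hp.1.memLp (E.measure f)).integrable (by norm_num)
    have h2 := (hq.1.memLp (E.measure f)).integrable (by norm_num)
    have := integral_add h1 h2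
    rw [← hp.2.2, ← hq.2.2, ← map_add, ← inner_add_left] at this
    exact this.symm
  | neg p _ hp =>
    obtain ⟨⟨hm, c, hc⟩, hs, hi⟩ := hp
    refine ⟨⟨hm.neg, c, fun x => by simpa using hc x⟩, fun f g => ?_, fun f => ?_⟩
    · have := hs f g
      simpa using this
    · have := integral_neg (μ := E.measure f) p.1
      rw [← hi, ← map_neg, ← inner_neg_left] at this
      exact this.symm

/-- The functional calculus for simple functions given by a resolution of the identity. -/
noncomputable def calculus : SpectralCalculus 𝕜 H ℝ≥0 where
  alg := Subring.closure (E.indicatorPairs : Set ((ℝ≥0 → ℝ) × (H →L[𝕜] H)))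
  measure := E.measure
  isFinite f := inferInstance
  measurable p hp := (properties_of_mem_closure E hp).1.1
  bounded p hp := (properties_of_mem_closure E hp).1.2
  isSymmetric p hp := (properties_of_mem_closure E hp).2.1
  inner_eq p hp := (properties_of_mem_closure E hp).2.2
  const_mem c := Subring.subset_closure ⟨c, Set.univ, MeasurableSet.univ, by
    rw [E.proj_univ, Set.indicator_univ]⟩
  dense ν _ g hg δ hδ := by
    obtain ⟨φ, hφ, -⟩ := hg.exists_simpleFunc_eLpNorm_sub_lt (by norm_num) hδ
    suffices h : ∀ φ : SimpleFunc ℝ≥0 ℝ, ∃ T : H →L[𝕜] H,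
        (⇑φ, T) ∈ Subring.closure (E.indicatorPairs : Set ((ℝ≥0 → ℝ) × (H →L[𝕜] H))) by
      obtain ⟨T, hT⟩ := h φ
      exact ⟨_, hT, hφ.le⟩
    intro φ
    induction φ using SimpleFunc.induction with
    | const c hs =>
      refine ⟨_, Subring.subset_closure ⟨c, _, hs, Prod.ext ?_ rfl⟩⟩
      ext x
      simp [SimpleFunc.coe_piecewise, Set.indicator, Set.piecewise]
    | add _ h1 h2 =>
      obtain ⟨T, hT⟩ := h1
      obtain ⟨S, hS⟩ := h2
      exact ⟨T + S, add_mem hT hS⟩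

/-- A symmetric operator is determined by its quadratic form, so the operator chosen in the
definition of `integral` is the one that the calculus provides. -/
theorem isOp_integral {g : ℝ≥0 → ℝ} (hg : BoundedMeasurable g) :
    E.calculus.IsOp g (E.integral g) := by
  obtain ⟨T, hT⟩ := E.calculus.exists_isOp hg
  have hTs := hT.isSymmetric hg
  have h : ∃ T : H →L[𝕜] H, IsSelfAdjoint T ∧
      ∀ f : H, inner 𝕜 (T f) f = ((∫ l : ℝ≥0, g l ∂(E.measure f) : ℝ) : 𝕜) :=
    ⟨T, ContinuousLinearMap.isSelfAdjoint_iff_isSymmetric.2 hTs, hT.inner_eq hg⟩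
  have heq : E.integral g = T := by
    rw [integral, dif_pos h]
    have hS := h.choose_spec
    have hSs := ContinuousLinearMap.isSelfAdjoint_iff_isSymmetric.1 hS.1
    have h0 := (hSs.sub hTs).inner_map_self_eq_zero.1 fun f => by
      have h2 := hT.inner_eq hg f
      have h3 := hS.2 f
      rw [LinearMap.sub_apply, inner_sub_left, sub_eq_zero]
      exact h3.trans h2.symm
    ext f
    exact sub_eq_zero.1 (DFunLike.congr_fun h0 f)
  rwa [heq]

end ResolutionOfIdentity

/-! ### Spectral projections and their transport to the half-line. -/

namespace SpectralCalculus

variable {𝕜 H Ω : Type*} [RCLike 𝕜] [NormedAddCommGroup H] [InnerProductSpace 𝕜 H]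
  [CompleteSpace H] [MeasurableSpace Ω] (C : SpectralCalculus 𝕜 H Ω)

/-- The spectral projection of a measurable set. -/
noncomputable def spectralProj {s : Set Ω} (hs : MeasurableSet s) : H →L[𝕜] H :=
  (C.exists_isOp (BoundedMeasurable.indicator hs)).choose

theorem isOp_spectralProj {s : Set Ω} (hs : MeasurableSet s) :
    C.IsOp (s.indicator 1) (C.spectralProj hs) :=
  (C.exists_isOp (BoundedMeasurable.indicator hs)).choose_spec

theorem isOp_sum_spectralProj {s : ℕ → Set Ω} (hs : ∀ i, MeasurableSet (s i))
    (hd : Pairwise (Function.onFun Disjoint s)) (F : Finset ℕ) :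
    C.IsOp ((⋃ i ∈ F, s i).indicator 1) (∑ i ∈ F, C.spectralProj (hs i)) := by
  classical
  induction F using Finset.induction_on with
  | empty =>
    simp only [Finset.sum_empty, Finset.notMem_empty, Set.iUnion_of_empty, Set.iUnion_empty,
      Set.indicator_empty]
    exact C.isOp_of_mem C.alg.zero_mem
  | insert a F ha ih =>
    have h := (C.isOp_spectralProj (hs a)).add ih (BoundedMeasurable.indicator (hs a))
      (BoundedMeasurable.indicator (F.measurableSet_biUnion fun i _ => hs i))
    rw [Finset.sum_insert ha, Finset.set_biUnion_insert, Set.indicator_union_of_disjoint]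
    · exact h
    · exact Set.disjoint_iUnion₂_right.2 fun i hi => hd fun h => ha (h ▸ hi)

theorem hasSum_spectralProj {s : ℕ → Set Ω} (hs : ∀ i, MeasurableSet (s i))
    (hd : Pairwise (Function.onFun Disjoint s)) (f : H) :
    HasSum (fun i => C.spectralProj (hs i) f) (C.spectralProj (MeasurableSet.iUnion hs) f) := by
  have hU := MeasurableSet.iUnion hs
  have hsum : HasSum (fun i => (C.measure f).real (s i)) ((C.measure f).real (⋃ i, s i)) := by
    have h1 := measure_iUnion (μ := C.measure f) hd hs
    have h2 : ∑' i, C.measure f (s i) ≠ ∞ := by rw [← h1]; exact measure_ne_top _ _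
    have h3 := ENNReal.hasSum_toReal h2
    rwa [← ENNReal.tsum_toReal_eq fun i => measure_ne_top _ _, ← h1] at h3
  -- By the isometry, the squared error of a partial sum is the spectral measure of the sets left
  -- out.
  have key : ∀ F : Finset ℕ, ‖C.spectralProj hU f - ∑ i ∈ F, C.spectralProj (hs i) f‖ ^ 2
      = (C.measure f).real (⋃ i, s i) - ∑ i ∈ F, (C.measure f).real (s i) := by
    intro F
    have hF : MeasurableSet (⋃ i ∈ F, s i) := F.measurableSet_biUnion fun i _ => hs i
    have hFU : (⋃ i ∈ F, s i) ⊆ ⋃ i, s i := Set.iUnion₂_subset_iUnion _ _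
    have hb1 := BoundedMeasurable.indicator hU
    have hb2 := BoundedMeasurable.indicator hF
    have h1 := (C.isOp_spectralProj hU).enorm_sub (C.isOp_sum_spectralProj hs hd F) hb1 hb2 f
    have h2 := norm_sq_eq_of_enorm_eq ((hb1.memLp _).sub (hb2.memLp _)) h1
    rw [sum_apply] at h2
    rw [h2, ← measureReal_biUnion_finset (fun i _ j _ hij => hd hij) (fun i _ => hs i),
      ← measureReal_sdiff hFU hF, ← integral_indicator_one (hU.diff hF)]
    refine integral_congr_ae (Filter.Eventually.of_forall fun x => ?_)
    change ((⋃ i, s i).indicator (1 : Ω → ℝ) x - (⋃ i ∈ F, s i).indicator 1 x) ^ 2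
      = ((⋃ i, s i) \ ⋃ i ∈ F, s i).indicator 1 x
    classical
    have hx := @hFU x
    simp only [Set.indicator_apply, Pi.one_apply, Set.mem_sdiff]
    by_cases h3 : x ∈ ⋃ i ∈ F, s i
    · simp only [h3, hx h3, not_true_eq_false, and_false, if_true, if_false]
      norm_num
    · by_cases h4 : x ∈ ⋃ i, s i
      · simp only [h3, h4, not_false_eq_true, and_self, if_true, if_false]
        norm_num
      · simp only [h3, h4, false_and, if_false]
        norm_num
  have h0 : Filter.Tendsto (fun F : Finset ℕ =>
      ‖C.spectralProj hU f - ∑ i ∈ F, C.spectralProj (hs i) f‖ ^ 2) Filter.atTop (nhds 0) := by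
    simp only [key]
    simpa using hsum.const_sub ((C.measure f).real (⋃ i, s i))
  have h1 := h0.sqrt
  simp only [Real.sqrt_sq (norm_nonneg _), Real.sqrt_zero] at h1
  refine tendsto_iff_norm_sub_tendsto_zero.2 (h1.congr fun F => norm_sub_rev _ _)

open Classical in
/-- The resolution of the identity obtained by transporting the spectral projections along a
measurable map to the half-line. -/
noncomputable def toResolution {τ : Ω → ℝ≥0} (hτ : Measurable τ) : ResolutionOfIdentity 𝕜 H where
  proj s := if hs : MeasurableSet s then C.spectralProj (hτ hs) else 0
  isStarProjection s hs := by
    rw [dif_pos hs]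
    exact (C.isOp_spectralProj (hτ hs)).isStarProjection (hτ hs)
  proj_univ := by
    rw [dif_pos MeasurableSet.univ]
    refine (C.isOp_spectralProj _).unique (S := 1) ?_ (BoundedMeasurable.indicator (hτ .univ))
    have h := C.isOp_const 1
    rwa [RCLike.ofReal_one, one_smul, ← Pi.one_def, ← Set.indicator_univ (1 : Ω → ℝ)] at h
  hasSum_iUnion s hs hd f := by
    have h := C.hasSum_spectralProj (fun i => hτ (hs i)) (fun i j hij => (hd hij).preimage τ) f
    rw [dif_pos (MeasurableSet.iUnion hs)]
    simp only [hs, dif_pos]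
    convert h using 2
    simp only [Set.preimage_iUnion]

theorem toResolution_measure {τ : Ω → ℝ≥0} (hτ : Measurable τ) (f : H) :
    (C.toResolution hτ).measure f = (C.measure f).map τ := by
  ext s hs
  have hb := BoundedMeasurable.indicator (hτ hs)
  have hP := C.isOp_spectralProj (hτ hs)
  have h1 : (C.toResolution hτ).proj s = C.spectralProj (hτ hs) := dif_pos hs
  rw [ResolutionOfIdentity.measure_apply _ _ hs, Measure.map_apply hτ hs, h1,
    ← inner_conj_symm, RCLike.conj_re, (hP f).inner_eq (hb.memLp _), integral_indicator_one (hτ hs),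
    ofReal_measureReal]

end SpectralCalculus

/-! ### Spectral measures of a bounded operator `0 ≤ R ≤ 1` through its moments. -/

section Moments

variable {𝕜 H : Type*} [RCLike 𝕜] [NormedAddCommGroup H] [InnerProductSpace 𝕜 H]

/-- The spectral measure of a symmetric operator on a finite-dimensional space with values of the
quadratic form in `[0, ‖f‖²]`. -/
theorem LinearMap.IsSymmetric.exists_measure_of_finiteDimensional [FiniteDimensional 𝕜 H]
    {S : H →ₗ[𝕜] H} (hS : S.IsSymmetric) (h0 : ∀ f, 0 ≤ RCLike.re (inner 𝕜 (S f) f))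
    (h1 : ∀ f, RCLike.re (inner 𝕜 (S f) f) ≤ ‖f‖ ^ 2) {f : H} (hf : ‖f‖ = 1) :
    ∃ ν : ProbabilityMeasure unitInterval, ∀ j : ℕ,
      ∫ x, (x : ℝ) ^ j ∂(ν : Measure unitInterval) = RCLike.re (inner 𝕜 ((S ^ j) f) f) := by
  set b := hS.eigenvectorBasis rfl
  set ev := hS.eigenvalues rfl
  have hb : ∀ i, S (b i) = (ev i : 𝕜) • b i := fun i => hS.apply_eigenvectorBasis rfl i
  have hmem : ∀ i, ev i ∈ unitInterval := by
    intro i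
    have h : RCLike.re (inner 𝕜 (S (b i)) (b i)) = ev i := by
      rw [hb, inner_smul_left, RCLike.conj_ofReal, RCLike.re_ofReal_mul, inner_self_eq_norm_sq,
        b.norm_eq_one]
      ring
    refine ⟨h ▸ h0 _, ?_⟩
    have := h1 (b i)
    rw [h, b.norm_eq_one] at this
    simpa using this
  have hbj : ∀ (j : ℕ) i, (S ^ j) (b i) = ((ev i ^ j : ℝ) : 𝕜) • b i := by
    intro j i
    induction j with
    | zero => simp
    | succ j ih => rw [pow_succ, Module.End.mul_apply, hb, map_smul, ih, smul_smul]; push_cast; ring_nf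
  have hsum : ∑ i, ‖inner 𝕜 (b i) f‖ ^ 2 = 1 := by rw [b.sum_sq_norm_inner_right, hf, one_pow]
  let ν : Measure unitInterval :=
    ∑ i, ENNReal.ofReal (‖inner 𝕜 (b i) f‖ ^ 2) • Measure.dirac ⟨ev i, hmem i⟩
  have hν : IsProbabilityMeasure ν := ⟨by
    simp only [ν, Measure.coe_finsetSum, Finset.sum_apply, Measure.smul_apply, measure_univ,
      smul_eq_mul, mul_one]
    rw [← ENNReal.ofReal_sum_of_nonneg fun i _ => sq_nonneg _, hsum, ENNReal.ofReal_one]⟩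
  refine ⟨⟨ν, hν⟩, fun j => ?_⟩
  change ∫ x, (x : ℝ) ^ j ∂ν = _
  have hint : ∀ i, Integrable (fun x : unitInterval => (x : ℝ) ^ j)
      (ENNReal.ofReal (‖inner 𝕜 (b i) f‖ ^ 2) •
        Measure.dirac (⟨ev i, hmem i⟩ : unitInterval)) := fun i =>
    (integrable_dirac (by simp)).smul_measure ENNReal.ofReal_ne_top
  rw [integral_finsetSum_measure fun i _ => hint i, ← b.sum_inner_mul_inner, map_sum]
  refine Finset.sum_congr rfl fun i _ => ?_
  have hj : inner 𝕜 ((S ^ j) f) (b i) = ((ev i ^ j : ℝ) : 𝕜) * inner 𝕜 f (b i) := by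
    rw [(hS.pow j) f (b i), hbj, inner_smul_right]
  rw [integral_smul_measure, integral_dirac, ENNReal.toReal_ofReal (sq_nonneg _), hj, mul_assoc,
    RCLike.re_ofReal_mul, inner_mul_symm_re_eq_norm, norm_mul, norm_inner_symm f (b i), smul_eq_mul]
  ring

variable {R : H →L[𝕜] H}

/-- Compress `R` to the span of `f, R f, …, R^n f`. The powers of the compression up to `n` agree
with those of `R` at `f`, and the finite-dimensional spectral theorem applies. -/
theorem exists_probabilityMeasure_moments_le (hR : (R : H →ₗ[𝕜] H).IsSymmetric)
    (h0 : ∀ f, 0 ≤ RCLike.re (inner 𝕜 (R f) f))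
    (h1 : ∀ f, RCLike.re (inner 𝕜 (R f) f) ≤ ‖f‖ ^ 2) {f : H} (hf : ‖f‖ = 1) (n : ℕ) :
    ∃ ν : ProbabilityMeasure unitInterval, ∀ j ≤ n,
      ∫ x, (x : ℝ) ^ j ∂(ν : Measure unitInterval) = RCLike.re (inner 𝕜 ((R ^ j) f) f) := by
  let K : Submodule 𝕜 H := Submodule.span 𝕜 (Set.range fun j : Fin (n + 1) => (R ^ (j : ℕ)) f)
  have hK : ∀ j ≤ n, (R ^ j) f ∈ K := fun j hj =>
    Submodule.subset_span ⟨⟨j, Nat.lt_succ_of_le hj⟩, rfl⟩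
  have : FiniteDimensional 𝕜 K := FiniteDimensional.span_of_finite 𝕜 (Set.finite_range _)
  let S : K →ₗ[𝕜] K := (K.orthogonalProjectionOnto.comp (R.comp K.subtypeL) : K →L[𝕜] K)
  have hSi : ∀ x y : K, inner 𝕜 (S x) y = inner 𝕜 (R x) (y : H) := fun x y =>
    K.inner_orthogonalProjectionOnto_eq_of_mem_right y (R x)
  have hSi' : ∀ x y : K, inner 𝕜 x (S y) = inner 𝕜 (x : H) (R y) := fun x y =>
    K.inner_orthogonalProjectionOnto_eq_of_mem_left x (R y)
  have hS : S.IsSymmetric := fun x y => by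
    rw [hSi, hSi']; exact hR x y
  let f' : K := ⟨f, by simpa using hK 0 (Nat.zero_le _)⟩
  have hpow : ∀ j ≤ n, (((S ^ j) f' : K) : H) = (R ^ j) f := by
    intro j
    induction j with
    | zero => intro _; rfl
    | succ j ih =>
      intro hj
      have hR' : R ((R ^ j) f) = (R ^ (j + 1)) f := by rw [pow_succ']; rfl
      have h : (((S ^ (j + 1)) f' : K) : H)
          = (K.orthogonalProjectionOnto (R (((S ^ j) f' : K) : H)) : H) := by
        rw [pow_succ']; rfl
      rw [h, ih (by omega), hR']
      exact K.orthogonalProjectionOnto_mem_subspace_eq_self ⟨_, hK _ hj⟩ |> congrArg Subtype.val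
  obtain ⟨ν, hν⟩ := hS.exists_measure_of_finiteDimensional
    (fun x => by rw [hSi]; exact h0 x) (fun x => by rw [hSi]; exact h1 x) (f := f') hf
  refine ⟨ν, fun j hj => ?_⟩
  rw [hν, Submodule.coe_inner, hpow j hj]

/-- Probability measures on `[0, 1]` are weakly compact and moments are integrals of continuous
functions, so an ultrafilter limit of the measures matching finitely many moments matches all of
them. -/
theorem exists_probabilityMeasure_moments (hR : (R : H →ₗ[𝕜] H).IsSymmetric)
    (h0 : ∀ f, 0 ≤ RCLike.re (inner 𝕜 (R f) f))
    (h1 : ∀ f, RCLike.re (inner 𝕜 (R f) f) ≤ ‖f‖ ^ 2) {f : H} (hf : ‖f‖ = 1) :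
    ∃ ν : ProbabilityMeasure unitInterval, ∀ j : ℕ,
      ∫ x, (x : ℝ) ^ j ∂(ν : Measure unitInterval) = RCLike.re (inner 𝕜 ((R ^ j) f) f) := by
  choose ν hν using fun n => exists_probabilityMeasure_moments_le hR h0 h1 hf n
  let U : Ultrafilter (ProbabilityMeasure unitInterval) := (Filter.hyperfilter ℕ).map ν
  have hU : Filter.Tendsto ν (Filter.hyperfilter ℕ : Filter ℕ) (nhds U.lim) := U.le_nhds_lim
  refine ⟨U.lim, fun j => ?_⟩
  have h := ProbabilityMeasure.tendsto_iff_forall_integral_tendsto.1 hU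
    (BoundedContinuousFunction.mkOfCompact ⟨fun x : unitInterval => (x : ℝ) ^ j, by fun_prop⟩)
  refine tendsto_nhds_unique h (tendsto_const_nhds.congr' ?_)
  refine Filter.Eventually.filter_mono Nat.hyperfilter_le_atTop ?_
  filter_upwards [Filter.eventually_ge_atTop j] with n hn
  exact (hν n j hn).symm

theorem exists_finiteMeasure_moments (hR : (R : H →ₗ[𝕜] H).IsSymmetric)
    (h0 : ∀ f, 0 ≤ RCLike.re (inner 𝕜 (R f) f))
    (h1 : ∀ f, RCLike.re (inner 𝕜 (R f) f) ≤ ‖f‖ ^ 2) (f : H) :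
    ∃ ν : Measure unitInterval, IsFiniteMeasure ν ∧ ∀ j : ℕ,
      ∫ x, (x : ℝ) ^ j ∂ν = RCLike.re (inner 𝕜 ((R ^ j) f) f) := by
  by_cases hf : f = 0
  · exact ⟨0, inferInstance, fun j => by simp [hf]⟩
  have hf' : ‖f‖ ≠ 0 := norm_ne_zero_iff.2 hf
  obtain ⟨ν, hν⟩ := exists_probabilityMeasure_moments hR h0 h1
    (f := ((‖f‖⁻¹ : ℝ) : 𝕜) • f) (by rw [norm_smul]; simp [hf'])
  refine ⟨ENNReal.ofReal (‖f‖ ^ 2) • (ν : Measure unitInterval),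
    (ν : Measure unitInterval).smul_finite ENNReal.ofReal_ne_top, fun j => ?_⟩
  rw [integral_smul_measure, hν, map_smul, inner_smul_left, inner_smul_right, RCLike.conj_ofReal,
    RCLike.re_ofReal_mul, RCLike.re_ofReal_mul, ENNReal.toReal_ofReal (sq_nonneg _), smul_eq_mul]
  field_simp

end Moments

/-! ### The polynomial calculus of `R`. -/

section Polynomial

open Polynomial

theorem exists_polynomial_eLpNorm_sub_le (ν : Measure unitInterval) [IsFiniteMeasure ν]
    {g : unitInterval → ℝ} (hg : MemLp g 2 ν) {δ : ℝ≥0∞} (hδ : δ ≠ 0) :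
    ∃ p : ℝ[X], eLpNorm (g - fun x : unitInterval => p.eval (x : ℝ)) 2 ν ≤ δ := by
  have hδ2 : δ / 2 ≠ 0 := by simpa using hδ
  obtain ⟨φ, hφ, -⟩ := hg.exists_boundedContinuous_eLpNorm_sub_le (by norm_num) hδ2
  -- A uniform error `c` costs `c ν(univ)^{1/2}` in `L²`; this must stay below `δ/2`.
  obtain ⟨c, hc, hcδ⟩ := ENNReal.exists_nnreal_pos_mul_lt
    (ENNReal.rpow_ne_top_of_nonneg (y := ((2 : ℝ≥0∞).toReal)⁻¹) (by positivity)
      (measure_ne_top ν Set.univ)) hδ2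
  obtain ⟨p, hp⟩ := exists_polynomial_near_continuousMap 0 1 φ.toContinuousMap c hc
  refine ⟨p, ?_⟩
  have hcont : Continuous fun x : unitInterval => p.eval (x : ℝ) := by fun_prop
  have h1 : eLpNorm (⇑φ - fun x : unitInterval => p.eval (x : ℝ)) 2 ν ≤ δ / 2 := by
    refine (eLpNorm_le_of_ae_bound (C := c) (Filter.Eventually.of_forall fun x => ?_)).trans ?_
    · have := (ContinuousMap.norm_coe_le_norm
        (p.toContinuousMapOn (Set.Icc 0 1) - φ.toContinuousMap) x).trans hp.le
      rw [ContinuousMap.sub_apply, norm_sub_rev] at this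
      exact this
    · rw [ENNReal.ofReal_coe_nnreal, mul_comm]
      exact hcδ.le
  calc eLpNorm (g - fun x : unitInterval => p.eval (x : ℝ)) 2 ν
      = eLpNorm ((g - ⇑φ) + (⇑φ - fun x : unitInterval => p.eval (x : ℝ))) 2 ν := by
        rw [sub_add_sub_cancel]
    _ ≤ _ := eLpNorm_add_le (hg.1.sub φ.continuous.aestronglyMeasurable)
        (φ.continuous.sub hcont).aestronglyMeasurable (by norm_num)
    _ ≤ δ / 2 + δ / 2 := add_le_add hφ h1
    _ = δ := ENNReal.add_halves δ

variable {𝕜 H : Type*} [RCLike 𝕜] [NormedAddCommGroup H] [InnerProductSpace 𝕜 H]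

/-- The pairs `(p, p(R))` for real polynomials `p`. -/
noncomputable def polynomialPairs (R : H →L[𝕜] H) :
    ℝ[X] →+* (unitInterval → ℝ) × (H →L[𝕜] H) :=
  RingHom.prod (RingHom.pi fun x : unitInterval => evalRingHom (x : ℝ))
    ((aeval R : 𝕜[X] →ₐ[𝕜] (H →L[𝕜] H)).toRingHom.comp (mapRingHom (algebraMap ℝ 𝕜)))

theorem polynomialPairs_fst (R : H →L[𝕜] H) (p : ℝ[X]) :
    (polynomialPairs R p).1 = fun x : unitInterval => p.eval (x : ℝ) := rfl

theorem polynomialPairs_monomial_snd (R : H →L[𝕜] H) (n : ℕ) (c : ℝ) :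
    (polynomialPairs R (monomial n c)).2 = (c : 𝕜) • R ^ n := by
  change aeval R ((monomial n c).map (algebraMap ℝ 𝕜)) = _
  rw [map_monomial, aeval_monomial, Algebra.smul_def]

theorem polynomialPairs_isSymmetric {R : H →L[𝕜] H} (hR : (R : H →ₗ[𝕜] H).IsSymmetric) (p : ℝ[X]) :
    ((polynomialPairs R p).2 : H →ₗ[𝕜] H).IsSymmetric := by
  induction p using Polynomial.induction_on' with
  | add p q hp hq => rw [map_add]; exact hp.add hq
  | monomial n c =>
    rw [polynomialPairs_monomial_snd]
    exact LinearMap.IsSymmetric.smul (RCLike.conj_ofReal c) (by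
      have h := hR.pow n
      rwa [← ContinuousLinearMap.toLinearMap_pow] at h)

theorem polynomialPairs_inner_eq {R : H →L[𝕜] H} {f : H} {ν : Measure unitInterval}
    [IsFiniteMeasure ν] (hν : ∀ j : ℕ, ∫ x, (x : ℝ) ^ j ∂ν = RCLike.re (inner 𝕜 ((R ^ j) f) f))
    (p : ℝ[X]) :
    RCLike.re (inner 𝕜 ((polynomialPairs R p).2 f) f) = ∫ x, (polynomialPairs R p).1 x ∂ν := by
  induction p using Polynomial.induction_on' with
  | add p q hp hq =>
    have hi (r : ℝ[X]) : Integrable (polynomialPairs R r).1 ν :=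
      (show Continuous fun x : unitInterval => r.eval (x : ℝ) by fun_prop).integrable_of_hasCompactSupport
        (HasCompactSupport.of_compactSpace _)
    have := integral_add (hi p) (hi q)
    rw [← hp, ← hq, ← map_add, ← inner_add_left] at this
    rw [map_add]
    exact this.symm
  | monomial n c =>
    rw [polynomialPairs_monomial_snd, polynomialPairs_fst, smul_apply,
      inner_smul_left, RCLike.conj_ofReal, RCLike.re_ofReal_mul, ← hν, ← integral_const_mul]
    simp only [eval_monomial]

/-- The functional calculus of a symmetric operator `0 ≤ R ≤ 1`. -/
noncomputable def polynomialCalculus {R : H →L[𝕜] H} (hR : (R : H →ₗ[𝕜] H).IsSymmetric)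
    (h0 : ∀ f, 0 ≤ RCLike.re (inner 𝕜 (R f) f))
    (h1 : ∀ f, RCLike.re (inner 𝕜 (R f) f) ≤ ‖f‖ ^ 2) : SpectralCalculus 𝕜 H unitInterval where
  alg := (polynomialPairs R).range
  measure f := (exists_finiteMeasure_moments hR h0 h1 f).choose
  isFinite f := (exists_finiteMeasure_moments hR h0 h1 f).choose_spec.1
  measurable := by
    rintro _ ⟨p, rfl⟩
    exact (show Continuous fun x : unitInterval => p.eval (x : ℝ) by fun_prop).measurable
  bounded := by
    rintro _ ⟨p, rfl⟩
    have hc : Continuous fun x : unitInterval => p.eval (x : ℝ) := by fun_prop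
    obtain ⟨c, hc⟩ := isCompact_univ.exists_bound_of_continuousOn hc.continuousOn
    exact ⟨c, fun x => hc x (Set.mem_univ x)⟩
  isSymmetric := by
    rintro _ ⟨p, rfl⟩
    exact polynomialPairs_isSymmetric hR p
  inner_eq := by
    rintro _ ⟨p, rfl⟩ f
    have := (exists_finiteMeasure_moments hR h0 h1 f).choose_spec.1
    exact polynomialPairs_inner_eq (exists_finiteMeasure_moments hR h0 h1 f).choose_spec.2 p
  const_mem c := ⟨monomial 0 c, Prod.ext
    (by ext x; simp [polynomialPairs_fst]) (by rw [polynomialPairs_monomial_snd, pow_zero])⟩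
  dense ν _ g hg δ hδ := by
    obtain ⟨p, hp⟩ := exists_polynomial_eLpNorm_sub_le ν hg hδ
    exact ⟨_, ⟨p, rfl⟩, hp⟩

theorem polynomialCalculus_isOp_id {R : H →L[𝕜] H} (hR : (R : H →ₗ[𝕜] H).IsSymmetric)
    (h0 : ∀ f, 0 ≤ RCLike.re (inner 𝕜 (R f) f))
    (h1 : ∀ f, RCLike.re (inner 𝕜 (R f) f) ≤ ‖f‖ ^ 2) :
    (polynomialCalculus hR h0 h1).IsOp (fun x => (x : ℝ)) R :=
  (polynomialCalculus hR h0 h1).isOp_of_mem (p := (fun x => (x : ℝ), R)) ⟨monomial 1 1, Prod.ext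
    (by ext x; simp [polynomialPairs_fst]) (by rw [polynomialPairs_monomial_snd]; simp)⟩

end Polynomial

/-! ### The spectral theorem for an unbounded non-negative self-adjoint operator. -/

section Resolvent

variable {𝕜 H : Type*} [RCLike 𝕜] [NormedAddCommGroup H] [InnerProductSpace 𝕜 H] [CompleteSpace H]
  {A : H →ₗ.[𝕜] H}

namespace IsNonnegSelfAdjoint

theorem inner_comm (hA : IsNonnegSelfAdjoint A) (f g : A.domain) :
    inner 𝕜 (A f) (g : H) = inner 𝕜 (f : H) (A g) := by
  have h := LinearPMap.adjoint_isFormalAdjoint hA.1.dense_domain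
  rw [LinearPMap.isSelfAdjoint_def.1 hA.1] at h
  exact h f g

theorem norm_le (hA : IsNonnegSelfAdjoint A) (f : A.domain) : ‖(f : H)‖ ≤ ‖(f : H) + A f‖ := by
  by_cases hf : ‖(f : H)‖ = 0
  · rw [hf]; exact norm_nonneg _
  have h1 : RCLike.re (inner 𝕜 ((f : H) + A f) (f : H)) ≤ ‖(f : H) + A f‖ * ‖(f : H)‖ :=
    re_inner_le_norm _ _
  rw [inner_add_left, map_add, inner_self_eq_norm_sq] at h1
  have h2 := hA.2 f
  have h3 : 0 < ‖(f : H)‖ := lt_of_le_of_ne (norm_nonneg _) (Ne.symm hf)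
  nlinarith

/-- The range of `1 + A` is closed because the graph is closed and `1 + A` is bounded below. A
vector `u` orthogonal to it satisfies `A* u = -u`, hence `A u = -u` by self-adjointness, and the
lower bound forces `u = 0`. -/
theorem exists_add_apply_eq (hA : IsNonnegSelfAdjoint A) (y : H) :
    ∃ f : A.domain, (f : H) + A f = y := by
  let L : A.domain →ₗ[𝕜] H := A.domain.subtype + A.toFun
  have hLf : ∀ f : A.domain, L f = (f : H) + A f := fun f => rfl
  let G : A.graph →L[𝕜] H :=
    (ContinuousLinearMap.fst 𝕜 H H + ContinuousLinearMap.snd 𝕜 H H).comp A.graph.subtypeL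
  have hGL : Set.range G = (LinearMap.range L : Set H) := by
    ext y
    constructor
    · rintro ⟨⟨p, hp⟩, rfl⟩
      obtain ⟨f, hf1, hf2⟩ := (LinearPMap.mem_graph_iff A).1 hp
      refine ⟨f, ?_⟩
      rw [hLf, hf1, hf2]
      rfl
    · rintro ⟨f, rfl⟩
      exact ⟨⟨_, A.mem_graph f⟩, rfl⟩
  have hcl : IsClosed (LinearMap.range L : Set H) := by
    rw [← hGL]
    have hc : IsClosed (A.graph : Set (H × H)) := hA.1.isClosed
    have : CompleteSpace A.graph := hc.completeSpace_coe
    refine AntilipschitzWith.isClosed_range (K := 2)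
      (AddMonoidHomClass.antilipschitz_of_bound G fun p => ?_) G.uniformContinuous
    obtain ⟨f, hf1, hf2⟩ := (LinearPMap.mem_graph_iff A).1 p.2
    have h1 := hA.norm_le f
    have h2 : ‖A f‖ ≤ ‖(f : H) + A f‖ + ‖(f : H)‖ := by
      simpa using norm_sub_le ((f : H) + A f) (f : H)
    have h3 : G p = (f : H) + A f := by rw [hf1, hf2]; rfl
    have h4 : ‖p‖ = max ‖(f : H)‖ ‖A f‖ := by rw [hf1, hf2]; rfl
    rw [h3, h4, NNReal.coe_ofNat]
    have := norm_nonneg (f : H)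
    exact max_le (by linarith) (by linarith)
  have horth : (LinearMap.range L)ᗮ = ⊥ := by
    rw [Submodule.eq_bot_iff]
    intro u hu
    have hu' : ∀ f : A.domain, inner 𝕜 (-u) (f : H) = inner 𝕜 u (A f) := by
      intro f
      have h := (Submodule.mem_orthogonal' _ _).1 hu (L f) ⟨f, rfl⟩
      rw [hLf, inner_add_right] at h
      rw [inner_neg_left]
      exact neg_eq_of_add_eq_zero_right h
    have hadj := LinearPMap.isSelfAdjoint_def.1 hA.1
    have hmem : u ∈ A.domain := by
      rw [← hadj]
      exact LinearPMap.mem_adjoint_domain_of_exists u ⟨-u, hu'⟩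
    have hval : A ⟨u, hmem⟩ = -u := by
      refine hA.1.dense_domain.eq_of_inner_left 𝕜 fun v hv => ?_
      rw [hA.inner_comm ⟨u, hmem⟩ ⟨v, hv⟩]
      exact (hu' ⟨v, hv⟩).symm
    have h := hA.norm_le ⟨u, hmem⟩
    rw [hval] at h
    simpa using h
  have htop : LinearMap.range L = ⊤ := by
    have : CompleteSpace (LinearMap.range L) := hcl.completeSpace_coe
    exact (Submodule.orthogonal_eq_bot_iff (K := LinearMap.range L)).1 horth
  obtain ⟨f, hf⟩ : y ∈ LinearMap.range L := htop ▸ Submodule.mem_top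
  exact ⟨f, hf⟩

/-- The resolvent `(1 + A)⁻¹`. -/
theorem exists_resolvent (hA : IsNonnegSelfAdjoint A) :
    ∃ R : H →L[𝕜] H, (R : H →ₗ[𝕜] H).IsSymmetric ∧ (∀ f, 0 ≤ RCLike.re (inner 𝕜 (R f) f)) ∧
      (∀ f, RCLike.re (inner 𝕜 (R f) f) ≤ ‖f‖ ^ 2) ∧
      (∀ y, ∃ h : R y ∈ A.domain, A ⟨R y, h⟩ = y - R y) ∧
      ∀ f : A.domain, R ((f : H) + A f) = f := by
  choose r hr using hA.exists_add_apply_eq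
  have hinj : ∀ f g : A.domain, (f : H) + A f = (g : H) + A g → f = g := by
    intro f g h
    have h1 := hA.norm_le (f - g)
    have h2 : ((f - g : A.domain) : H) + A (f - g) = 0 := by
      rw [A.map_sub, Submodule.coe_sub, ← sub_eq_zero.2 h]; abel
    rw [h2, norm_zero] at h1
    exact sub_eq_zero.1 (Subtype.ext (norm_le_zero_iff.1 h1))
  let L : H →ₗ[𝕜] H :=
    { toFun := fun y => r y
      map_add' := fun y z => by
        rw [← Submodule.coe_add, hinj (r (y + z)) (r y + r z)]
        rw [hr, A.map_add, Submodule.coe_add]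
        nth_rw 1 [← hr y, ← hr z]
        abel
      map_smul' := fun c y => by
        rw [RingHom.id_apply, ← Submodule.coe_smul, hinj (r (c • y)) (c • r y)]
        rw [hr, A.map_smul, Submodule.coe_smul, ← smul_add, hr] }
  have hL : ∀ y, L y = r y := fun _ => rfl
  have hsym : L.IsSymmetric := fun y z => by
    rw [hL, hL]
    conv_lhs => rw [← hr z]
    conv_rhs => rw [← hr y]
    rw [inner_add_right, inner_add_left, hA.inner_comm]
  refine ⟨⟨L, hsym.continuous⟩, hsym, fun y => ?_, fun y => ?_, fun y => ⟨(r y).2, ?_⟩, fun f => ?_⟩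
  · change 0 ≤ RCLike.re (inner 𝕜 (r y : H) y)
    have h : inner 𝕜 (r y : H) y = inner 𝕜 (r y : H) (r y) + inner 𝕜 (A (r y)) (r y : H) := by
      rw [hA.inner_comm, ← inner_add_right, hr]
    rw [h, map_add, inner_self_eq_norm_sq]
    exact add_nonneg (sq_nonneg _) (hA.2 _)
  · change RCLike.re (inner 𝕜 (r y : H) y) ≤ ‖y‖ ^ 2
    refine (re_inner_le_norm _ _).trans ?_
    rw [sq]
    gcongr
    exact (hA.norm_le (r y)).trans_eq (by rw [hr])
  · exact eq_sub_of_add_eq' (hr y)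
  · exact congrArg Subtype.val (hinj _ _ (hr _))

theorem exists_represents (hA : IsNonnegSelfAdjoint A) :
    ∃ E : ResolutionOfIdentity 𝕜 H, E.Represents A := by
  obtain ⟨R, hR, h0, h1, hRA, hAR⟩ := hA.exists_resolvent
  set C := polynomialCalculus hR h0 h1
  have hid : C.IsOp (fun x => (x : ℝ)) R := polynomialCalculus_isOp_id hR h0 h1
  have hidb : BoundedMeasurable fun x : unitInterval => (x : ℝ) :=
    ⟨measurable_subtype_coe, 1, fun x => abs_le.2 ⟨by linarith [x.2.1], x.2.2⟩⟩
  have hinj : ∀ y, R y = 0 → y = 0 := by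
    intro y hy
    obtain ⟨h, hy'⟩ := hRA y
    have h2 : (⟨R y, h⟩ : A.domain) = 0 := Subtype.ext hy
    rw [h2, A.map_zero, hy, sub_zero] at hy'
    exact hy'.symm
  -- `R` kills the range of the spectral projection of `{0}`, and `R` is injective, so no spectral
  -- measure charges `0`.
  have hzero : ∀ f, ∀ᵐ x : unitInterval ∂C.measure f, (x : ℝ) ≠ 0 := by
    intro f
    have hs : MeasurableSet ({0} : Set unitInterval) := measurableSet_singleton _
    have hb := BoundedMeasurable.indicator hs
    have hP := C.isOp_spectralProj hs
    have h2 := (hid.mul hP hidb hb).unique (S := 0) (by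
      have : (fun x : unitInterval => (x : ℝ)) * ({0} : Set unitInterval).indicator 1 = 0 := by
        ext x; by_cases hx : x = 0 <;> simp [hx]
      rw [this]
      exact C.isOp_of_mem C.alg.zero_mem) (hidb.mul hb)
    have h3 : C.spectralProj hs f = 0 := hinj _ (DFunLike.congr_fun h2 f)
    have h4 := (hP f).inner_eq (hb.memLp _)
    rw [h3, inner_zero_left, map_zero, integral_indicator_one hs, eq_comm, measureReal_eq_zero_iff]
      at h4
    rw [ae_iff]
    convert h4 using 2
    ext x
    simp
  -- `R = (1 + A)⁻¹` turns the spectral value `x` of `R` into `λ = 1/x - 1`. At `x = 0` this gives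
  -- `τ = 0`, harmless because that point is null.
  let τ : unitInterval → ℝ≥0 := fun x => Real.toNNReal ((x : ℝ)⁻¹ - 1)
  have hτ : Measurable τ := (measurable_subtype_coe.inv.sub_const 1).real_toNNReal
  have hτv : ∀ x : unitInterval, (x : ℝ) ≠ 0 → (τ x : ℝ) = (x : ℝ)⁻¹ - 1 := by
    intro x hx
    have : 0 < (x : ℝ) := lt_of_le_of_ne x.2.1 (Ne.symm hx)
    exact Real.coe_toNNReal _ (sub_nonneg.2 ((one_le_inv₀ this).2 x.2.2))
  have hxτ : ∀ x : unitInterval, (x : ℝ) ^ 2 * τ x = (x : ℝ) - (x : ℝ) ^ 2 := by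
    intro x
    by_cases hx : (x : ℝ) = 0
    · simp [hx]
    · rw [hτv x hx]; field_simp
  have hxτ2 : ∀ x : unitInterval, (x : ℝ) ^ 2 * (τ x : ℝ) ^ 2 ≤ 1 := by
    intro x
    by_cases hx : (x : ℝ) = 0
    · simp [hx]
    · have : (x : ℝ) ^ 2 * ((x : ℝ)⁻¹ - 1) ^ 2 = (1 - x) ^ 2 := by field_simp
      rw [hτv x hx, this]
      have h5 := x.2.1
      have h6 := x.2.2
      nlinarith
  -- Elements of the domain are of the form `R y`. The density `x²` tames the unbounded `τ`: away
  -- from `0`, `x²τ = x - x²` and `x²τ² = (1 - x)²`.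
  have hdens : ∀ y, C.measure (R y)
      = (C.measure y).withDensity fun x => ENNReal.ofReal ((x : ℝ) ^ 2) :=
    fun y => (hid y).measure_eq_withDensity (hidb.memLp _)
  have hdm : Measurable fun x : unitInterval => ENNReal.ofReal ((x : ℝ) ^ 2) :=
    (measurable_subtype_coe.pow_const 2).ennreal_ofReal
  refine ⟨C.toResolution hτ, fun f => ?_, fun f => ?_⟩
  · rw [C.toResolution_measure hτ, lintegral_map (by fun_prop) hτ]
    constructor
    · intro hf
      have hfR := hAR ⟨f, hf⟩
      rw [← show R (f + A ⟨f, hf⟩) = f from hfR, hdens, lintegral_withDensity_eq_lintegral_mul _ hdm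
        (by fun_prop)]
      refine (lintegral_mono (g := fun _ => 1) fun x => ?_).trans_lt (by simp)
      have : ((τ x : ℝ≥0∞)) ^ 2 = ENNReal.ofReal ((τ x : ℝ) ^ 2) := by
        rw [ENNReal.ofReal_pow (NNReal.coe_nonneg _), ENNReal.ofReal_coe_nnreal]
      rw [Pi.mul_apply, this, ← ENNReal.ofReal_mul (sq_nonneg _)]
      exact ENNReal.ofReal_le_one.2 (hxτ2 x)
    · intro hf
      have hτ2 : MemLp (fun x => (τ x : ℝ)) 2 (C.measure f) := by
        refine ⟨hτ.coe_nnreal_real.aestronglyMeasurable, ?_⟩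
        rw [eLpNorm_lt_top_iff_lintegral_rpow_enorm_lt_top (by norm_num) (by norm_num)]
        simpa using hf
      -- The vector `v` represents `(1 + A) f`: since `x(1 + τ(x)) = 1` almost everywhere, `R v =
      -- f`, which puts `f` in the domain.
      have hg : MemLp (fun x => (τ x : ℝ) + 1) 2 (C.measure f) := hτ2.add (memLp_const 1)
      obtain ⟨v, hv⟩ := C.exists_isValue hg
      have h2 := hid.isValue_mul hidb hv hg
      have h3 : C.IsValue (fun _ => 1) f f := by
        have := C.isOp_const 1 f
        simpa using this
      have h4 : f = R v := by
        refine h3.unique h2 (memLp_const 1) ?_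
        filter_upwards [hzero f] with x hx
        rw [Pi.mul_apply, hτv x hx]
        field_simp
        ring
      rw [h4]
      exact (hRA v).1
  · rw [C.toResolution_measure hτ, integral_map hτ.aemeasurable (by fun_prop)]
    obtain ⟨y, hy⟩ : ∃ y, (f : H) + A f = y := ⟨_, rfl⟩
    have hfR : R y = f := hy ▸ hAR f
    have hAf : A f = y - R y := by rw [hfR, ← hy]; abel
    have h2 : ∫ x, (x : ℝ) ∂C.measure y - ∫ x, (x : ℝ) ^ 2 ∂C.measure y
        = ∫ x, (τ x : ℝ) ∂C.measure f := by
      rw [← hfR, hdens, integral_withDensity_eq_integral_toReal_smul hdm (by simp),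
        ← integral_sub ((hidb.memLp _).integrable (by norm_num)) (hidb.memLp _).integrable_sq]
      refine integral_congr_ae (Filter.Eventually.of_forall fun x => ?_)
      dsimp only
      rw [ENNReal.toReal_ofReal (sq_nonneg _), smul_eq_mul, hxτ]
    have h3 : inner 𝕜 y (R y) = inner 𝕜 (R y) y := (hR y y).symm
    rw [hAf, ← hfR, inner_sub_left, h3, hid.inner_eq hidb, inner_self_eq_norm_sq_to_K, hfR, ← h2,
      ← (hid y).norm_sq (hidb.memLp _), hfR]
    push_cast
    rfl

theorem spectralResolution_represents (hA : IsNonnegSelfAdjoint A) :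
    (spectralResolution A).Represents A := by
  rw [spectralResolution, dif_pos hA.exists_represents]
  exact hA.exists_represents.choose_spec

end IsNonnegSelfAdjoint

end Resolvent

/-! ### Functions of the operator that contract `L¹`. -/

namespace ResolutionOfIdentity

section Calculus

variable {𝕜 H : Type*} [RCLike 𝕜] [NormedAddCommGroup H] [InnerProductSpace 𝕜 H] [CompleteSpace H]
  (E : ResolutionOfIdentity 𝕜 H)

theorem integral_const (c : ℝ) : E.integral (fun _ => c) = (c : 𝕜) • 1 :=
  (E.isOp_integral (BoundedMeasurable.const c)).unique (E.calculus.isOp_const c)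
    (BoundedMeasurable.const c)

theorem integral_mul {g h : ℝ≥0 → ℝ} (hg : BoundedMeasurable g) (hh : BoundedMeasurable h) :
    E.integral (g * h) = E.integral g * E.integral h :=
  (E.isOp_integral (hg.mul hh)).unique ((E.isOp_integral hg).mul (E.isOp_integral hh) hg hh)
    (hg.mul hh)

theorem integral_add {g h : ℝ≥0 → ℝ} (hg : BoundedMeasurable g) (hh : BoundedMeasurable h) :
    E.integral (g + h) = E.integral g + E.integral h :=
  (E.isOp_integral (hg.add hh)).unique ((E.isOp_integral hg).add (E.isOp_integral hh) hg hh)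
    (hg.add hh)

theorem norm_sq_integral_apply {g : ℝ≥0 → ℝ} (hg : BoundedMeasurable g) (f : H) :
    ‖E.integral g f‖ ^ 2 = ∫ l, g l ^ 2 ∂E.measure f :=
  (E.isOp_integral hg f).norm_sq (hg.memLp _)

theorem measure_integral_apply {g : ℝ≥0 → ℝ} (hg : BoundedMeasurable g) (f : H) :
    E.measure (E.integral g f)
      = (E.measure f).withDensity fun l => ENNReal.ofReal (g l ^ 2) :=
  (E.isOp_integral hg f).measure_eq_withDensity (hg.memLp _)

theorem tendsto_integral_apply {g : ℕ → ℝ≥0 → ℝ} {h : ℝ≥0 → ℝ} {c : ℝ}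
    (hg : ∀ n, Measurable (g n)) (hgc : ∀ n l, |g n l| ≤ c)
    (hlim : ∀ l, Filter.Tendsto (fun n => g n l) Filter.atTop (nhds (h l))) (f : H) :
    Filter.Tendsto (fun n => E.integral (g n) f) Filter.atTop (nhds (E.integral h f)) := by
  have hgb n : BoundedMeasurable (g n) := ⟨hg n, c, hgc n⟩
  have hhc : ∀ l, |h l| ≤ c := fun l => le_of_tendsto' (hlim l).abs fun n => hgc n l
  have hhb : BoundedMeasurable h :=
    ⟨measurable_of_tendsto_metrizable hg (tendsto_pi_nhds.2 hlim), c, hhc⟩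
  have key n : ‖E.integral (g n) f - E.integral h f‖ ^ 2 = ∫ l, (g n l - h l) ^ 2 ∂E.measure f :=
    norm_sq_eq_of_enorm_eq (((hgb n).memLp _).sub (hhb.memLp _))
      ((E.isOp_integral (hgb n)).enorm_sub (E.isOp_integral hhb) (hgb n) hhb f)
  have h0 : Filter.Tendsto (fun n => ‖E.integral (g n) f - E.integral h f‖ ^ 2)
      Filter.atTop (nhds 0) := by
    simp only [key]
    have := tendsto_integral_of_dominated_convergence (μ := E.measure f)
      (F := fun n l => (g n l - h l) ^ 2) (f := fun _ => 0) (fun _ => (c + c) ^ 2)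
      (fun n => (((hg n).sub hhb.1).pow_const 2).aestronglyMeasurable) (integrable_const _)
      (fun n => Filter.Eventually.of_forall fun l => ?_)
      (Filter.Eventually.of_forall fun l => ?_)
    · simpa using this
    · rw [Real.norm_eq_abs, abs_pow]
      gcongr
      exact (abs_sub _ _).trans (add_le_add (hgc n l) (hhc l))
    · simpa using ((hlim l).sub_const (h l)).pow 2
  have h1 := h0.sqrt
  simp only [Real.sqrt_sq (norm_nonneg _), Real.sqrt_zero] at h1
  exact tendsto_iff_norm_sub_tendsto_zero.2 h1

end Calculus

section Contractions

variable {𝕜 X : Type*} [RCLike 𝕜] [MeasurableSpace X] {μ : Measure X}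

/-- Borel functions `g` with values in `[0, 1]` for which `∫ g dE` contracts the `L¹` norm. -/
structure ContractsL1 (E : ResolutionOfIdentity 𝕜 (Lp 𝕜 2 μ)) (g : ℝ≥0 → ℝ) : Prop where
  measurable : Measurable g
  nonneg : ∀ l, 0 ≤ g l
  le_one : ∀ l, g l ≤ 1
  eLpNorm_le : ∀ f : Lp 𝕜 2 μ, eLpNorm (E.integral g f) 1 μ ≤ eLpNorm f 1 μ

namespace ContractsL1

variable {E : ResolutionOfIdentity 𝕜 (Lp 𝕜 2 μ)} {g h : ℝ≥0 → ℝ}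

theorem abs_le_one (hg : E.ContractsL1 g) (l : ℝ≥0) : |g l| ≤ 1 :=
  abs_le.2 ⟨by linarith [hg.nonneg l], hg.le_one l⟩

theorem bounded (hg : E.ContractsL1 g) : BoundedMeasurable g := ⟨hg.measurable, 1, hg.abs_le_one⟩

theorem one (E : ResolutionOfIdentity 𝕜 (Lp 𝕜 2 μ)) : E.ContractsL1 fun _ => 1 where
  measurable := measurable_const
  nonneg _ := zero_le_one
  le_one _ := le_rfl
  eLpNorm_le f := by rw [E.integral_const]; simp

theorem mul (hg : E.ContractsL1 g) (hh : E.ContractsL1 h) : E.ContractsL1 (g * h) where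
  measurable := hg.measurable.mul hh.measurable
  nonneg l := mul_nonneg (hg.nonneg l) (hh.nonneg l)
  le_one l := mul_le_one₀ (hg.le_one l) (hh.nonneg l) (hh.le_one l)
  eLpNorm_le f := by
    rw [E.integral_mul hg.bounded hh.bounded]
    exact (hg.eLpNorm_le _).trans (hh.eLpNorm_le f)

theorem pow (hg : E.ContractsL1 g) (n : ℕ) : E.ContractsL1 (g ^ n) := by
  induction n with
  | zero => exact one E
  | succ n ih => rw [pow_succ]; exact ih.mul hg

theorem convex (hg : E.ContractsL1 g) (hh : E.ContractsL1 h) {a b : ℝ} (ha : 0 ≤ a) (hb : 0 ≤ b)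
    (hab : a + b ≤ 1) : E.ContractsL1 ((fun _ => a) * g + (fun _ => b) * h) where
  measurable := (measurable_const.mul hg.measurable).add (measurable_const.mul hh.measurable)
  nonneg l := add_nonneg (mul_nonneg ha (hg.nonneg l)) (mul_nonneg hb (hh.nonneg l))
  le_one l := (add_le_add (mul_le_of_le_one_right ha (hg.le_one l))
    (mul_le_of_le_one_right hb (hh.le_one l))).trans hab
  eLpNorm_le f := by
    have hga := (BoundedMeasurable.const (Ω := ℝ≥0) a).mul hg.bounded
    have hhb := (BoundedMeasurable.const (Ω := ℝ≥0) b).mul hh.bounded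
    have h1 : E.integral ((fun _ => a) * g + (fun _ => b) * h) f
        = (a : 𝕜) • E.integral g f + (b : 𝕜) • E.integral h f := by
      rw [E.integral_add hga hhb, E.integral_mul (BoundedMeasurable.const a) hg.bounded,
        E.integral_mul (BoundedMeasurable.const b) hh.bounded, E.integral_const, E.integral_const]
      simp
    have hae : (((a : 𝕜) • E.integral g f + (b : 𝕜) • E.integral h f : Lp 𝕜 2 μ) : X → 𝕜)
        =ᵐ[μ] (a : 𝕜) • (E.integral g f : X → 𝕜) + (b : 𝕜) • (E.integral h f : X → 𝕜) :=
      (Lp.coeFn_add _ _).trans ((Lp.coeFn_smul _ _).add (Lp.coeFn_smul _ _))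
    have hn : ∀ c : ℝ, 0 ≤ c → ‖(c : 𝕜)‖ₑ = ENNReal.ofReal c := fun c hc => by
      rw [← ofReal_norm, RCLike.norm_ofReal, abs_of_nonneg hc]
    rw [h1, eLpNorm_congr_ae hae]
    refine (eLpNorm_add_le ((Lp.aestronglyMeasurable _).const_smul _)
      ((Lp.aestronglyMeasurable _).const_smul _) le_rfl).trans ?_
    rw [eLpNorm_const_smul, eLpNorm_const_smul, hn a ha, hn b hb]
    calc _ ≤ ENNReal.ofReal a * eLpNorm f 1 μ + ENNReal.ofReal b * eLpNorm f 1 μ := by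
          gcongr
          · exact hg.eLpNorm_le f
          · exact hh.eLpNorm_le f
      _ = ENNReal.ofReal (a + b) * eLpNorm f 1 μ := by
          rw [← add_mul, ENNReal.ofReal_add ha hb]
      _ ≤ 1 * eLpNorm f 1 μ := by
          gcongr
          exact ENNReal.ofReal_le_one.2 hab
      _ = _ := one_mul _

/-- Dominated convergence gives convergence in `L²`, hence almost everywhere along a subsequence;
Fatou's lemma then bounds the `L¹` norm. -/
theorem of_tendsto {G : ℕ → ℝ≥0 → ℝ} (hG : ∀ n, E.ContractsL1 (G n))
    (hlim : ∀ l, Filter.Tendsto (fun n => G n l) Filter.atTop (nhds (g l))) : E.ContractsL1 g where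
  measurable := measurable_of_tendsto_metrizable (fun n => (hG n).measurable)
    (tendsto_pi_nhds.2 hlim)
  nonneg l := ge_of_tendsto' (hlim l) fun n => (hG n).nonneg l
  le_one l := le_of_tendsto' (hlim l) fun n => (hG n).le_one l
  eLpNorm_le f := by
    have h1 := E.tendsto_integral_apply (fun n => (hG n).measurable)
      (fun n l => (hG n).abs_le_one l) hlim f
    obtain ⟨ns, -, hns⟩ := (tendstoInMeasure_of_tendsto_Lp h1).exists_seq_tendsto_ae
    refine (Lp.eLpNorm_lim_le_liminf_eLpNorm (fun n => Lp.aestronglyMeasurable _) _ hns).trans ?_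
    refine (Filter.liminf_le_liminf (v := fun _ => eLpNorm f 1 μ)
      (Filter.Eventually.of_forall fun n => (hG _).eLpNorm_le f)).trans ?_
    rw [Filter.liminf_const]

end ContractsL1

end Contractions

end ResolutionOfIdentity

/-! ### Subordination: from the heat semigroup to the Poisson semigroup. -/

/-- The iteration `y ↦ (x + y²) / 2`, started at `0`. -/
noncomputable def sqrtIter (x : ℝ) : ℕ → ℝ
  | 0 => 0
  | n + 1 => (x + sqrtIter x n ^ 2) / 2

/-- The equation `y = (x + y²)/2` means `(1 - y)² = 1 - x`, and the iterates increase to its smaller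
root. Each step is a convex combination of `x` and a square, so it preserves `L¹` contractivity. -/
theorem tendsto_sqrtIter {x : ℝ} (h0 : 0 ≤ x) (h1 : x ≤ 1) :
    Filter.Tendsto (sqrtIter x) Filter.atTop (nhds (1 - √(1 - x))) := by
  have hs0 : 0 ≤ √(1 - x) := Real.sqrt_nonneg _
  have hs2 : √(1 - x) ^ 2 = 1 - x := Real.sq_sqrt (by linarith)
  have hs1 : √(1 - x) ≤ 1 := Real.sqrt_le_one.2 (by linarith)
  have hnn : ∀ n, 0 ≤ sqrtIter x n := by
    intro n
    cases n with
    | zero => exact le_rfl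
    | succ n => rw [sqrtIter]; positivity
  have hle : ∀ n, sqrtIter x n ≤ 1 - √(1 - x) := by
    intro n
    induction n with
    | zero => rw [sqrtIter]; linarith
    | succ n ih =>
      rw [sqrtIter]
      have := hnn n
      nlinarith
  have hmono : Monotone (sqrtIter x) := by
    refine monotone_nat_of_le_succ fun n => ?_
    rw [sqrtIter]
    have := hle n
    nlinarith
  have hlim := tendsto_atTop_ciSup hmono ⟨_, by rintro _ ⟨n, rfl⟩; exact hle n⟩
  set L := ⨆ n, sqrtIter x n
  have hL : L ≤ 1 - √(1 - x) := le_of_tendsto' hlim hle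
  have h2 : Filter.Tendsto (fun n => sqrtIter x (n + 1)) Filter.atTop (nhds ((x + L ^ 2) / 2)) := by
    simp only [sqrtIter]
    exact ((hlim.pow 2).const_add x).div_const 2
  have h3 := tendsto_nhds_unique h2 ((Filter.tendsto_add_atTop_iff_nat 1).2 hlim)
  have h4 : L = 1 - √(1 - x) := by
    have : (1 - L - √(1 - x)) * (1 - L + √(1 - x)) = 0 := by nlinarith
    rcases mul_eq_zero.1 this with h | h <;> linarith
  rwa [h4] at hlim

/-- With `m = (n + 1)²`, the bounds `1 - y ≤ e^{-y} ≤ 1/(1 + y)` squeeze the expression between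
`x/(1 + x/m)` and `x`. -/
theorem tendsto_sq_mul_one_sub_exp_neg_div_sq {x : ℝ} (hx : 0 ≤ x) :
    Filter.Tendsto (fun n : ℕ => ((n : ℝ) + 1) ^ 2 * (1 - Real.exp (-((((n : ℝ) + 1) ^ 2)⁻¹ * x))))
      Filter.atTop (nhds x) := by
  have h0 : Filter.Tendsto (fun n : ℕ => (((n : ℝ) + 1) ^ 2)⁻¹) Filter.atTop (nhds 0) := by
    have := (tendsto_one_div_add_atTop_nhds_zero_nat (𝕜 := ℝ)).pow 2
    simpa using this
  have h1 : Filter.Tendsto (fun n : ℕ => x / (1 + (((n : ℝ) + 1) ^ 2)⁻¹ * x))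
      Filter.atTop (nhds x) := by
    have : Filter.Tendsto (fun n : ℕ => 1 + (((n : ℝ) + 1) ^ 2)⁻¹ * x) Filter.atTop (nhds 1) := by
      simpa using (h0.mul_const x).const_add 1
    have h2 := (tendsto_const_nhds (x := x)).div this one_ne_zero
    rwa [div_one] at h2
  refine tendsto_of_tendsto_of_tendsto_of_le_of_le h1 tendsto_const_nhds (fun n => ?_) fun n => ?_
  · have hm : (0 : ℝ) < ((n : ℝ) + 1) ^ 2 := by positivity
    set m := ((n : ℝ) + 1) ^ 2
    have hu : 0 ≤ m⁻¹ * x := by positivity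
    have h2 := Real.add_one_le_exp (m⁻¹ * x)
    have h3 : Real.exp (-(m⁻¹ * x)) ≤ (1 + m⁻¹ * x)⁻¹ := by
      rw [Real.exp_neg]
      exact inv_anti₀ (by linarith) (by linarith)
    calc x / (1 + m⁻¹ * x) = m * (1 - (1 + m⁻¹ * x)⁻¹) := by
          have : 1 + m⁻¹ * x ≠ 0 := by positivity
          field_simp
          ring
      _ ≤ _ := by gcongr
  · have hm : (0 : ℝ) < ((n : ℝ) + 1) ^ 2 := by positivity
    dsimp only
    set m := ((n : ℝ) + 1) ^ 2
    have h2 := Real.add_one_le_exp (-(m⁻¹ * x))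
    calc m * (1 - Real.exp (-(m⁻¹ * x))) ≤ m * (m⁻¹ * x) := by gcongr; linarith
      _ = x := by field_simp

namespace ResolutionOfIdentity.ContractsL1

variable {𝕜 X : Type*} [RCLike 𝕜] [MeasurableSpace X] {μ : Measure X}
  {E : ResolutionOfIdentity 𝕜 (Lp 𝕜 2 μ)} {g : ℝ≥0 → ℝ}

theorem sqrtIter (hg : E.ContractsL1 g) (n : ℕ) : E.ContractsL1 fun l => _root_.sqrtIter (g l) n := by
  induction n with
  | zero =>
    have := hg.convex hg (le_refl 0) (le_refl 0) (by norm_num)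
    convert this using 1
    ext l
    simp [_root_.sqrtIter]
  | succ n ih =>
    have := hg.convex (ih.pow 2) (a := 1 / 2) (b := 1 / 2) (by norm_num) (by norm_num) (by norm_num)
    convert this using 1
    ext l
    simp only [_root_.sqrtIter, Pi.add_apply, Pi.mul_apply, Pi.pow_apply]
    ring

theorem one_sub_sqrt (hg : E.ContractsL1 g) : E.ContractsL1 fun l => 1 - √(1 - g l) :=
  of_tendsto hg.sqrtIter fun l => tendsto_sqrtIter (hg.nonneg l) (hg.le_one l)

theorem exp (hg : E.ContractsL1 g) {c : ℝ} (hc : 0 ≤ c) :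
    E.ContractsL1 fun l => Real.exp (c * (g l - 1)) := by
  obtain ⟨N, hN⟩ := exists_nat_ge c
  -- For `m ≥ c`, the base `1 + c(g - 1)/m` is a convex combination of `1` and `g`; the shift by `N
  -- + 1` ensures this and keeps `m` positive.
  have hn (n : ℕ) : E.ContractsL1 fun l =>
      (1 + c * (g l - 1) / ((n + (N + 1) : ℕ) : ℝ)) ^ (n + (N + 1)) := by
    have hpos : (0 : ℝ) < ((n + (N + 1) : ℕ) : ℝ) := by positivity
    have hle : c / ((n + (N + 1) : ℕ) : ℝ) ≤ 1 := by
      rw [div_le_one hpos]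
      push_cast
      linarith [n.cast_nonneg (α := ℝ)]
    have h := ((one E).convex hg (a := 1 - c / ((n + (N + 1) : ℕ) : ℝ))
      (b := c / ((n + (N + 1) : ℕ) : ℝ)) (by linarith) (by positivity) (by linarith)).pow
        (n + (N + 1))
    convert h using 1
    ext l
    simp only [Pi.add_apply, Pi.mul_apply, Pi.pow_apply]
    congr 1
    ring
  refine of_tendsto hn fun l => ?_
  exact (Real.tendsto_one_add_div_pow_exp (c * (g l - 1))).comp
    (Filter.tendsto_add_atTop_nat (N + 1))

theorem exp_neg_sqrt (h : ∀ t : ℝ, 0 < t → E.ContractsL1 fun l => Real.exp (-t * l)) {t : ℝ}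
    (ht : 0 ≤ t) : E.ContractsL1 fun l => Real.exp (-t * √l) := by
  -- With `r = (n + 1)⁻²` and `c = t/√r`, the exponent is `-t √((1 - e^{-rl})/r)`, which tends to
  -- `-t√l`.
  have hn (n : ℕ) : E.ContractsL1 fun l => Real.exp (t * ((n : ℝ) + 1) *
      (1 - √(1 - Real.exp (-(((n : ℝ) + 1) ^ 2)⁻¹ * l)) - 1)) :=
    (h _ (by positivity)).one_sub_sqrt.exp (by positivity)
  refine of_tendsto hn fun l => ?_
  have h1 := (((tendsto_sq_mul_one_sub_exp_neg_div_sq l.coe_nonneg).sqrt.const_mul (-t))).rexp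
  refine h1.congr fun n => ?_
  congr 1
  rw [Real.sqrt_mul (by positivity), Real.sqrt_sq (by positivity), neg_mul (((n : ℝ) + 1) ^ 2)⁻¹]
  ring

end ResolutionOfIdentity.ContractsL1

/-! ### The differential inequality and the integrals it is applied to. -/

theorem mul_sq_le_sq_of_hasDerivAt {u v w : ℝ → ℝ} {N K β ε : ℝ} (hβ : 0 ≤ β) (hε : 0 < ε)
    (hε1 : ε < 1) (hN : 0 < N) (hu : ∀ s, 0 < s → HasDerivAt u (v s) s)
    (hv : ∀ s, 0 < s → HasDerivAt v (w s) s) (hv0 : ∀ s, 0 < s → v s ≤ 0)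
    (hK : ∀ s, 0 < s → -K ≤ v s) (hu0 : Filter.Tendsto u (nhdsWithin 0 (Set.Ioi 0)) (nhds N))
    (hw : ∀ s, 0 < s → ε * N ≤ u s → β * u s ≤ w s) :
    (1 - ε ^ 2) * β * N ^ 2 ≤ K ^ 2 := by
  rcases hβ.eq_or_lt with rfl | hβ
  · simp [sq_nonneg]
  have hanti : AntitoneOn u (Set.Ioi 0) := by
    refine antitoneOn_of_deriv_nonpos (convex_Ioi 0)
      (fun s hs => (hu s hs).continuousAt.continuousWithinAt) ?_ ?_
    · rw [interior_Ioi]; exact fun s hs => (hu s hs).differentiableAt.differentiableWithinAt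
    · rw [interior_Ioi]; intro s hs; rw [(hu s hs).deriv]; exact hv0 s hs
  -- If `u` stayed above `εN`, then `v' = w ≥ βεN` would make `v` positive eventually.
  have hex : ∃ T, 0 < T ∧ u T ≤ ε * N := by
    by_contra! hcon
    have hmono : MonotoneOn (fun s => v s - β * (ε * N) * s) (Set.Ioi 0) := by
      have hd : ∀ s, 0 < s → HasDerivAt (fun s => v s - β * (ε * N) * s) (w s - β * (ε * N)) s :=
        fun s hs => (hv s hs).sub (by simpa using (hasDerivAt_id s).const_mul (β * (ε * N)))
      refine monotoneOn_of_deriv_nonneg (convex_Ioi 0)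
        (fun s hs => (hd s hs).continuousAt.continuousWithinAt) ?_ ?_
      · rw [interior_Ioi]; exact fun s hs => (hd s hs).differentiableAt.differentiableWithinAt
      · rw [interior_Ioi]
        intro s hs
        rw [(hd s hs).deriv]
        have h1 := hw s hs (hcon s hs).le
        have h2 := mul_le_mul_of_nonneg_left (hcon s hs).le hβ.le
        linarith
    have hk : 0 < β * (ε * N) := by positivity
    have hK1 := hK 1 one_pos
    have hv1 := hv0 1 one_pos
    -- Over a time `(K + 1)/(βεN)` the function `v` rises by at least `K + 1` from a value at least
    -- `-K`.
    have hs : 0 < 1 + (K + 1) / (β * (ε * N)) := by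
      have : 0 ≤ (K + 1) / (β * (ε * N)) := by apply div_nonneg <;> linarith
      linarith
    have h1 := hmono (Set.mem_Ioi.2 one_pos) (Set.mem_Ioi.2 hs)
      (by have : 0 ≤ (K + 1) / (β * (ε * N)) := by apply div_nonneg <;> linarith
          linarith)
    have h2 := hv0 _ hs
    have h3 : β * (ε * N) * (1 + (K + 1) / (β * (ε * N))) = β * (ε * N) + (K + 1) := by
      field_simp
    simp only [h3] at h1
    linarith
  obtain ⟨T, hT, huT⟩ := hex
  have hεN : ε * N < N := by nlinarith
  obtain ⟨s₀, ⟨hs₀, hs₀T⟩, hus₀⟩ : ∃ s, (0 < s ∧ s < T) ∧ ε * N < u s := by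
    have h1 := hu0.eventually (lt_mem_nhds hεN)
    have h2 : ∀ᶠ s in nhdsWithin (0 : ℝ) (Set.Ioi 0), 0 < s ∧ s < T := Ioo_mem_nhdsGT hT
    exact (h2.and h1).exists
  obtain ⟨T', ⟨hsT', -⟩, huT'⟩ : ∃ T' ∈ Set.Icc s₀ T, u T' = ε * N :=
    intermediate_value_Icc' hs₀T.le
      (fun s hs => (hu s (hs₀.trans_le hs.1)).continuousAt.continuousWithinAt) ⟨huT, hus₀.le⟩
  have hT' : 0 < T' := hs₀.trans_le hsT'
  -- The derivative is `2v(w - βu)`, with `v ≤ 0` and `w ≥ βu` while `u ≥ εN = u(T')`.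
  have hF : AntitoneOn (fun s => v s ^ 2 - β * u s ^ 2) (Set.Ioc 0 T') := by
    have hd : ∀ s, 0 < s → HasDerivAt (fun s => v s ^ 2 - β * u s ^ 2)
        (2 * v s * w s - β * (2 * u s * v s)) s := fun s hs => by
      have h := ((hv s hs).pow 2).sub (((hu s hs).pow 2).const_mul β)
      norm_num at h
      exact h
    refine antitoneOn_of_deriv_nonpos (convex_Ioc 0 T')
      (fun s hs => (hd s hs.1).continuousAt.continuousWithinAt) ?_ ?_
    · rw [interior_Ioc]
      exact fun s hs => (hd s hs.1).differentiableAt.differentiableWithinAt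
    · rw [interior_Ioc]
      intro s hs
      rw [(hd s hs.1).deriv]
      have h1 := hw s hs.1 (huT' ▸ hanti (Set.mem_Ioi.2 hs.1) (Set.mem_Ioi.2 hT') hs.2.le)
      have h2 := hv0 s hs.1
      nlinarith
  have hlim : Filter.Tendsto (fun s => β * u s ^ 2 - β * (ε * N) ^ 2)
      (nhdsWithin 0 (Set.Ioi 0)) (nhds (β * N ^ 2 - β * (ε * N) ^ 2)) :=
    ((hu0.pow 2).const_mul β).sub_const _
  have hle : β * N ^ 2 - β * (ε * N) ^ 2 ≤ K ^ 2 := by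
    refine le_of_tendsto hlim ?_
    filter_upwards [Ioo_mem_nhdsGT hT'] with s hs
    have h1 := hF ⟨hs.1, hs.2.le⟩ ⟨hT', le_rfl⟩ hs.2.le
    simp only [huT'] at h1
    have h2 := hv0 s hs.1
    have h3 := hK s hs.1
    nlinarith [sq_nonneg (v T')]
  linarith

theorem hasDerivAt_integral_pow_mul_exp_neg_sqrt (ν : Measure ℝ≥0) [IsFiniteMeasure ν] (n : ℕ)
    {s : ℝ} (hs : 0 < s) :
    HasDerivAt (fun s => ∫ l : ℝ≥0, (-√(l : ℝ)) ^ n * Real.exp (s * -√(l : ℝ)) ∂ν)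
      (∫ l : ℝ≥0, (-√(l : ℝ)) ^ (n + 1) * Real.exp (s * -√(l : ℝ)) ∂ν) s := by
  refine ProbabilityTheory.hasDerivAt_integral_pow_mul_exp_real
    (X := fun l : ℝ≥0 => -√(l : ℝ)) ?_ n
  refine interior_maximal (fun t ht => ?_) isOpen_Ioi (Set.mem_Ioi.2 hs)
  refine Integrable.of_bound (by fun_prop) 1 (Filter.Eventually.of_forall fun l => ?_)
  rw [Real.norm_eq_abs, Real.abs_exp, Real.exp_le_one_iff, mul_neg, neg_nonpos]
  exact mul_nonneg (Set.mem_Ioi.1 ht).le (Real.sqrt_nonneg _)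

theorem tendsto_integral_exp_neg_sqrt (ν : Measure ℝ≥0) [IsFiniteMeasure ν] :
    Filter.Tendsto (fun s => ∫ l : ℝ≥0, Real.exp (s * -√(l : ℝ)) ∂ν)
      (nhdsWithin 0 (Set.Ioi 0)) (nhds (ν.real Set.univ)) := by
  have h1 : ν.real Set.univ = ∫ _ : ℝ≥0, (1 : ℝ) ∂ν := by simp
  rw [h1]
  refine tendsto_integral_filter_of_dominated_convergence (fun _ => 1)
    (Filter.Eventually.of_forall fun s => by fun_prop) ?_ (integrable_const _)
    (Filter.Eventually.of_forall fun l => ?_)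
  · filter_upwards [self_mem_nhdsWithin] with s hs
    refine Filter.Eventually.of_forall fun l => ?_
    rw [Real.norm_eq_abs, Real.abs_exp, Real.exp_le_one_iff, mul_neg, neg_nonpos]
    exact mul_nonneg (Set.mem_Ioi.1 hs).le (Real.sqrt_nonneg _)
  · have : Continuous fun s : ℝ => Real.exp (s * -√(l : ℝ)) := by fun_prop
    have h2 := this.tendsto 0
    rw [zero_mul, Real.exp_zero] at h2
    exact h2.mono_left nhdsWithin_le_nhds

/-- The bound `e^y ≥ y⁴/4!` at `y = s√l`. -/
theorem sq_mul_exp_neg_sqrt_le {s : ℝ} (hs : 0 < s) (l : ℝ≥0) :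
    (l : ℝ) ^ 2 * Real.exp (s * -√(l : ℝ)) ≤ 24 / s ^ 4 := by
  have h1 := Real.pow_div_factorial_le_exp (s * √(l : ℝ)) (by positivity) 4
  have h2 : √(l : ℝ) ^ 4 = (l : ℝ) ^ 2 := by
    rw [show 4 = 2 * 2 by norm_num, pow_mul, Real.sq_sqrt l.coe_nonneg]
  rw [mul_pow, h2, div_le_iff₀ (by positivity)] at h1
  norm_num [Nat.factorial] at h1
  rw [mul_neg, Real.exp_neg, ← div_eq_mul_inv, div_le_div_iff₀ (Real.exp_pos _) (by positivity)]
  linarith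

/-! ### The Nash inequality along the Poisson semigroup. -/

section Nash

variable {𝕜 X : Type*} [RCLike 𝕜] [MeasurableSpace X] {μ : Measure X}

/-- A Nash inequality for functions of unit `L¹` norm extends to the unit ball of `L¹`. -/
theorem nash_of_eLpNorm_le_one (A : Lp 𝕜 2 μ →ₗ.[𝕜] Lp 𝕜 2 μ) {B : ℝ≥0 → ℝ≥0} (hB : Monotone B)
    (hNash : ∀ f : A.domain, eLpNorm (f : Lp 𝕜 2 μ) 1 μ = 1 →
      ‖(f : Lp 𝕜 2 μ)‖ ^ 2 * (B (‖(f : Lp 𝕜 2 μ)‖₊ ^ 2) : ℝ)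
        ≤ RCLike.re (inner 𝕜 (A f) (f : Lp 𝕜 2 μ)))
    (f : A.domain) (hf : eLpNorm (f : Lp 𝕜 2 μ) 1 μ ≤ 1) :
    ‖(f : Lp 𝕜 2 μ)‖ ^ 2 * (B (‖(f : Lp 𝕜 2 μ)‖₊ ^ 2) : ℝ)
        ≤ RCLike.re (inner 𝕜 (A f) (f : Lp 𝕜 2 μ)) := by
  by_cases h0 : (f : Lp 𝕜 2 μ) = 0
  · simp [h0]
  have hpos : eLpNorm (f : Lp 𝕜 2 μ) 1 μ ≠ 0 := by
    rw [Ne, eLpNorm_eq_zero_iff (Lp.aestronglyMeasurable _) one_ne_zero]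
    exact fun h => h0 ((Lp.eq_zero_iff_ae_eq_zero).2 h)
  have htop : eLpNorm (f : Lp 𝕜 2 μ) 1 μ ≠ ∞ := ne_top_of_le_ne_top ENNReal.one_ne_top hf
  obtain ⟨r, hr⟩ : ∃ r : ℝ≥0, (r : ℝ≥0∞) = eLpNorm (f : Lp 𝕜 2 μ) 1 μ :=
    ⟨_, ENNReal.coe_toNNReal htop⟩
  have hr0 : r ≠ 0 := by rintro rfl; exact hpos (by rw [← hr]; rfl)
  have hr1 : r ≤ 1 := by rw [← hr] at hf; exact_mod_cast hf
  have hc1 : 1 ≤ r⁻¹ := (one_le_inv₀ (pos_iff_ne_zero.2 hr0)).2 hr1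
  have hcn : ‖(((r⁻¹ : ℝ≥0) : ℝ) : 𝕜)‖₊ = r⁻¹ := by
    ext; rw [coe_nnnorm, RCLike.norm_ofReal, NNReal.abs_eq]
  set c : 𝕜 := (((r⁻¹ : ℝ≥0) : ℝ) : 𝕜) with hc
  have h1 : eLpNorm ((c • f : A.domain) : Lp 𝕜 2 μ) 1 μ = 1 := by
    rw [Submodule.coe_smul, eLpNorm_congr_ae (Lp.coeFn_smul _ _), eLpNorm_const_smul, ← hr,
      enorm_eq_nnnorm, hcn, ← ENNReal.coe_mul, inv_mul_cancel₀ hr0, ENNReal.coe_one]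
  have h2 := hNash _ h1
  have hn : ‖c‖ = ((r⁻¹ : ℝ≥0) : ℝ) := by rw [← coe_nnnorm, hcn]
  rw [A.map_smul, Submodule.coe_smul, inner_smul_left, inner_smul_right, hc, RCLike.conj_ofReal,
    RCLike.re_ofReal_mul, RCLike.re_ofReal_mul, ← hc, norm_smul, nnnorm_smul, hcn, hn, mul_pow,
    mul_pow, ← mul_assoc, ← sq, mul_assoc] at h2
  have h3 : (0 : ℝ) < ((r⁻¹ : ℝ≥0) : ℝ) ^ 2 := by
    have : (1 : ℝ) ≤ ((r⁻¹ : ℝ≥0) : ℝ) := hc1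
    positivity
  -- After cancelling the common factor `r⁻²`, the inequality for `r⁻¹ f` has `B` at `r⁻² ‖f‖² ≥
  -- ‖f‖²`, where it is at least as large.
  refine le_trans ?_ (le_of_mul_le_mul_left h2 h3)
  gcongr
  exact hB (le_mul_of_one_le_left zero_le (one_le_pow₀ hc1))

end Nash

namespace ResolutionOfIdentity

variable {𝕜 H : Type*} [RCLike 𝕜] [NormedAddCommGroup H] [InnerProductSpace 𝕜 H] [CompleteSpace H]
  (E : ResolutionOfIdentity 𝕜 H)

theorem boundedMeasurable_exp_neg_sqrt {t : ℝ} (ht : 0 ≤ t) :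
    BoundedMeasurable fun l : ℝ≥0 => Real.exp (-t * √(l : ℝ)) := by
  refine ⟨by fun_prop, 1, fun l => ?_⟩
  rw [Real.abs_exp, Real.exp_le_one_iff, neg_mul, neg_nonpos]
  exact mul_nonneg ht (Real.sqrt_nonneg _)

theorem exp_neg_half_sqrt_sq (s : ℝ) (l : ℝ≥0) :
    Real.exp (-(s / 2) * √(l : ℝ)) ^ 2 = Real.exp (s * -√(l : ℝ)) := by
  rw [← Real.exp_nat_mul]
  congr 1
  push_cast
  ring

theorem norm_sq_poisson {s : ℝ} (hs : 0 < s) (f : H) :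
    ‖E.integral (fun l : ℝ≥0 => Real.exp (-(s / 2) * √(l : ℝ))) f‖ ^ 2
      = ∫ l : ℝ≥0, Real.exp (s * -√(l : ℝ)) ∂E.measure f := by
  rw [E.norm_sq_integral_apply (boundedMeasurable_exp_neg_sqrt (by positivity))]
  simp only [exp_neg_half_sqrt_sq]

theorem measure_poisson {s : ℝ} (hs : 0 < s) (f : H) :
    E.measure (E.integral (fun l : ℝ≥0 => Real.exp (-(s / 2) * √(l : ℝ))) f)
      = (E.measure f).withDensity fun l => ENNReal.ofReal (Real.exp (s * -√(l : ℝ))) := by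
  rw [E.measure_integral_apply (boundedMeasurable_exp_neg_sqrt (by positivity))]
  simp only [exp_neg_half_sqrt_sq]

/-- The Poisson semigroup maps all of `H` into the domain of `A`, so the Nash inequality can be used
although `f` itself need not lie there. -/
theorem lintegral_sq_measure_poisson_lt_top {s : ℝ} (hs : 0 < s) (f : H) :
    ∫⁻ l : ℝ≥0, (l : ℝ≥0∞) ^ 2
      ∂E.measure (E.integral (fun l : ℝ≥0 => Real.exp (-(s / 2) * √(l : ℝ))) f) < ∞ := by
  rw [E.measure_poisson hs, lintegral_withDensity_eq_lintegral_mul _ (by fun_prop) (by fun_prop)]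
  refine (lintegral_mono (g := fun _ => ENNReal.ofReal (24 / s ^ 4)) fun l => ?_).trans_lt
    (by rw [lintegral_const]; exact ENNReal.mul_lt_top ENNReal.ofReal_lt_top (measure_lt_top _ _))
  have : (l : ℝ≥0∞) ^ 2 = ENNReal.ofReal ((l : ℝ) ^ 2) := by
    rw [ENNReal.ofReal_pow (NNReal.coe_nonneg _), ENNReal.ofReal_coe_nnreal]
  rw [Pi.mul_apply, this, ← ENNReal.ofReal_mul (Real.exp_nonneg _), mul_comm]
  exact ENNReal.ofReal_le_ofReal (sq_mul_exp_neg_sqrt_le hs l)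

theorem integral_measure_poisson {s : ℝ} (hs : 0 < s) (f : H) :
    ∫ l : ℝ≥0, (l : ℝ)
      ∂E.measure (E.integral (fun l : ℝ≥0 => Real.exp (-(s / 2) * √(l : ℝ))) f)
      = ∫ l : ℝ≥0, (-√(l : ℝ)) ^ 2 * Real.exp (s * -√(l : ℝ)) ∂E.measure f := by
  rw [E.measure_poisson hs, integral_withDensity_eq_integral_toReal_smul (by fun_prop) (by simp)]
  refine integral_congr_ae (Filter.Eventually.of_forall fun l => ?_)
  dsimp only
  rw [ENNReal.toReal_ofReal (Real.exp_nonneg _), neg_sq, Real.sq_sqrt l.coe_nonneg, smul_eq_mul,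
    mul_comm]

end ResolutionOfIdentity

theorem fracPowForm_half {𝕜 H : Type*} [RCLike 𝕜] [NormedAddCommGroup H] [InnerProductSpace 𝕜 H]
    [CompleteSpace H] (A : H →ₗ.[𝕜] H) (f : H) :
    fracPowForm A (1 / 2) f = ∫ l : ℝ≥0, √(l : ℝ) ∂(spectralResolution A).measure f := by
  simp only [fracPowForm, Real.sqrt_eq_rpow]

theorem integrable_sqrt_of_mem_fracPowDomain {𝕜 H : Type*} [RCLike 𝕜] [NormedAddCommGroup H]
    [InnerProductSpace 𝕜 H] [CompleteSpace H] {A : H →ₗ.[𝕜] H} {f : H}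
    (hf : f ∈ fracPowDomain A (1 / 2)) :
    Integrable (fun l : ℝ≥0 => √(l : ℝ)) ((spectralResolution A).measure f) := by
  have h1 : Integrable (fun l : ℝ≥0 => (l : ℝ)) ((spectralResolution A).measure f) := by
    refine ⟨by fun_prop, ?_⟩
    simp only [fracPowDomain, Set.mem_ofPred_eq] at hf
    norm_num at hf
    simpa [HasFiniteIntegral] using hf
  refine ((integrable_const (1 : ℝ)).add h1).mono' (by fun_prop)
    (Filter.Eventually.of_forall fun l => ?_)
  rw [Real.norm_eq_abs, abs_of_nonneg (Real.sqrt_nonneg _)]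
  change √(l : ℝ) ≤ 1 + l
  exact Real.sqrt_le_iff.2 ⟨by positivity, by nlinarith [l.coe_nonneg]⟩

theorem mainTheorem2 {𝕜 : Type*} [RCLike 𝕜] {X : Type*} [MeasurableSpace X] (μ : Measure X)
    [SigmaFinite μ] (A : Lp 𝕜 2 μ →ₗ.[𝕜] Lp 𝕜 2 μ) (hA : IsNonnegSelfAdjoint A)
    (hT : ∀ t : ℝ, 0 < t → ∀ f : Lp 𝕜 2 μ,
      eLpNorm (heatSemigroup A t f) 1 μ ≤ eLpNorm f 1 μ)
    (B : ℝ≥0 → ℝ≥0) (hB : Monotone B)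
    (hNash : ∀ f : A.domain, eLpNorm (f : Lp 𝕜 2 μ) 1 μ = 1 →
      ‖(f : Lp 𝕜 2 μ)‖ ^ 2 * (B (‖(f : Lp 𝕜 2 μ)‖₊ ^ 2) : ℝ)
        ≤ RCLike.re (inner 𝕜 (A f) (f : Lp 𝕜 2 μ)))
    (ε : ℝ≥0) (hε₀ : 0 < ε) (hε₁ : ε < 1)
    (f : Lp 𝕜 2 μ) (hf : f ∈ fracPowDomain A (1 / 2)) (hf₁ : eLpNorm f 1 μ = 1) :
    (1 - (ε : ℝ) ^ 2) ^ (1 / 2 : ℝ) * ‖f‖ ^ 2 * (B (ε * ‖f‖₊ ^ 2) : ℝ) ^ (1 / 2 : ℝ)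
      ≤ fracPowForm A (1 / 2) f := by
  have hrep := hA.spectralResolution_represents
  have hsqrt := integrable_sqrt_of_mem_fracPowDomain hf
  rw [fracPowForm_half]
  set E := spectralResolution A with hE
  have hheat : ∀ t : ℝ, 0 < t → E.ContractsL1 fun l => Real.exp (-t * l) := fun t ht =>
    { measurable := by fun_prop
      nonneg := fun l => Real.exp_nonneg _
      le_one := fun l => by
        rw [Real.exp_le_one_iff, neg_mul, neg_nonpos]
        exact mul_nonneg ht.le l.coe_nonneg
      eLpNorm_le := hT t ht }
  have hpoisson : ∀ t : ℝ, 0 ≤ t → E.ContractsL1 fun l => Real.exp (-t * √(l : ℝ)) :=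
    fun t ht => ResolutionOfIdentity.ContractsL1.exp_neg_sqrt hheat ht
  have hf0 : f ≠ 0 := by
    rintro rfl
    rw [eLpNorm_congr_ae (Lp.coeFn_zero _ _ _), eLpNorm_zero] at hf₁
    exact zero_ne_one hf₁
  have hN : 0 < ‖f‖ ^ 2 := pow_pos (norm_pos_iff.2 hf0) 2
  have hK0 : 0 ≤ ∫ l : ℝ≥0, √(l : ℝ) ∂E.measure f := integral_nonneg fun l => Real.sqrt_nonneg _
  have hexp : ∀ s : ℝ, 0 < s → ∀ l : ℝ≥0, Real.exp (s * -√(l : ℝ)) ≤ 1 := fun s hs l => by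
    rw [Real.exp_le_one_iff, mul_neg, neg_nonpos]
    exact mul_nonneg hs.le (Real.sqrt_nonneg _)
  have hmain := mul_sq_le_sq_of_hasDerivAt
    (u := fun s => ∫ l : ℝ≥0, (-√(l : ℝ)) ^ 0 * Real.exp (s * -√(l : ℝ)) ∂E.measure f)
    (v := fun s => ∫ l : ℝ≥0, (-√(l : ℝ)) ^ 1 * Real.exp (s * -√(l : ℝ)) ∂E.measure f)
    (w := fun s => ∫ l : ℝ≥0, (-√(l : ℝ)) ^ 2 * Real.exp (s * -√(l : ℝ)) ∂E.measure f)
    (N := ‖f‖ ^ 2) (K := ∫ l : ℝ≥0, √(l : ℝ) ∂E.measure f) (β := B (ε * ‖f‖₊ ^ 2)) (ε := ε)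
    (NNReal.coe_nonneg _) hε₀ hε₁ hN
    (fun s hs => hasDerivAt_integral_pow_mul_exp_neg_sqrt _ 0 hs)
    (fun s hs => hasDerivAt_integral_pow_mul_exp_neg_sqrt _ 1 hs)
    (fun s hs => integral_nonpos fun l => by
      simp only [pow_one, neg_mul, Pi.zero_apply, neg_nonpos]
      positivity)
    (fun s hs => by
      rw [← integral_neg]
      refine integral_mono hsqrt.neg (hsqrt.mono' (by fun_prop)
        (Filter.Eventually.of_forall fun l => ?_)) fun l => ?_
      · rw [pow_one, norm_mul, norm_neg, Real.norm_eq_abs, Real.norm_eq_abs, Real.abs_exp,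
          abs_of_nonneg (Real.sqrt_nonneg _)]
        exact mul_le_of_le_one_right (Real.sqrt_nonneg _) (hexp s hs l)
      · simp only [pow_one, neg_mul, neg_le_neg_iff]
        exact mul_le_of_le_one_right (Real.sqrt_nonneg _) (hexp s hs l))
    (by
      have h1 := tendsto_integral_exp_neg_sqrt (E.measure f)
      rw [ResolutionOfIdentity.measureReal_apply E f MeasurableSet.univ, E.proj_univ] at h1
      simpa using h1)
    -- The inequality `βu ≤ w`: with `h` the Poisson evolution of `f` at time `s/2`, `u(s) = ‖h‖²`,
    -- `w(s) = (A h, h)` and `‖h‖₁ ≤ 1`, so Nash applies to `h`, and `‖h‖² ≥ ε‖f‖²` bounds `B`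
    -- below.
    (fun s hs hus => by
      rw [← E.integral_measure_poisson hs]
      simp only [pow_zero, one_mul] at hus ⊢
      rw [← E.norm_sq_poisson hs] at hus ⊢
      set h := E.integral (fun l : ℝ≥0 => Real.exp (-(s / 2) * √(l : ℝ))) f
      have hmem : h ∈ A.domain := (hrep.1 h).2 (E.lintegral_sq_measure_poisson_lt_top hs f)
      have h1 := nash_of_eLpNorm_le_one A hB hNash ⟨h, hmem⟩
        (((hpoisson (s / 2) (by positivity)).eLpNorm_le f).trans hf₁.le)
      rw [hrep.2 ⟨h, hmem⟩, RCLike.ofReal_re] at h1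
      refine le_trans ?_ h1
      rw [mul_comm]
      gcongr
      exact hB (by exact_mod_cast hus))
  have hε2 : 0 ≤ 1 - (ε : ℝ) ^ 2 := by
    have : (ε : ℝ) < 1 := hε₁
    nlinarith [ε.coe_nonneg]
  rw [← Real.sqrt_eq_rpow, ← Real.sqrt_eq_rpow]
  refine (sq_le_sq₀ (by positivity) hK0).1 ?_
  rw [mul_pow, mul_pow, Real.sq_sqrt hε2, Real.sq_sqrt (NNReal.coe_nonneg _)]
  linarith
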